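/- **Theorem 5.4 (with Theorem 5.7).** Let $\mathcal L_{\circ,\triangle}$ be the language of formulas built from propositional variables $p_0,p_1,\dots$ with $\neg,\wedge,\vee,\circ,\triangle$, and let $\mathcal L_{\mathsf{BD}}$ be its fragment over $\neg,\wedge,\vee$. Write $\bullet\phi$ for $\neg\circ\phi$. A valuation assigns to each variable a value in $\{\mathbf T,\mathbf B,\mathbf N,\mathbf F\}$ and extends to formulas as follows: $\wedge$ and $\vee$ are meet and join in the lattice $\mathbf F<\mathbf B,\mathbf N<\mathbf T$ (with $\mathbf B,\mathbf N$ incomparable); $\neg$ swaps $\mathbf T,\mathbf F$ and fixes $\mathbf B,\mathbf N$; $\circ\phi$ is $\mathbf T$ if $\phi$ is $\mathbf T$ or $\mathbf F$, and $\mathbf F$ otherwise; $\triangle\phi$ is $\mathbf T$ if $\phi$ is $\mathbf T$ or $\mathbf B$, and $\mathbf F$ otherwise. $\Gamma\models\chi$ means that every valuation giving all formulas of $\Gamma$ a value in $\{\mathbf T,\mathbf B\}$ also gives $\chi$ a value in $\{\mathbf T,\mathbf B\}$; $\bot$ is a formula with constant value $\mathbf F$. Atomic $\mathcal L_\circ$-literals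 are $p,\neg p,\circ p,\bullet p$, and $\mathcal L_\triangle$-literals are $p,\neg p,\triangle p,\neg\triangle p,\triangle\neg p,\neg\triangle\neg p$, for variables $p$; for each of the two languages, a term is a conjunction of such literals. A *BD abduction problem* is a triple $\mathbb P=\langle\Gamma,\psi,\mathsf H\rangle$ where $\Gamma\subseteq\mathcal L_{\mathsf{BD}}$ is finite, $\psi\in\mathcal L_{\mathsf{BD}}$, $\Gamma\not\models\psi$, and $\mathsf H$ is a finite set of such literals. For either fixed language ($\mathcal L_\circ$ or $\mathcal L_\triangle$), a *proper solution* of $\mathbb P$ is a term $\tau$ of that language, composed of literals in $\mathsf H$, such that $\Gamma,\tau\models\psi$, $\Gamma,\tau\not\models\bot$ and $\tau\not\models\psi$. A proper solution $\tau$ is *theory-minimal* if there is no proper solution $\phi$ in the same language with $\Gamma,\tau\models\phi$ and $\Gamma,\phi\not\models\tau$. Problems and terms are given as words over a finite alphabet, in a standard way (with indices of variables in binary). For $k\ge 1$, a language $L$ is in $\Sigma^{\mathsf P}_k$ if there are a polynomial $q$ and a relation $R$ decidable in deterministic polynomial time such that $x\in L$ iff $\exists y_1\forall y_2\cdots Q_k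 y_k\,R(x,y_1,\dots,y_k)$, where the quantifiers alternate and range over binary words of length at most $q(|x|)$; and $L$ is in $\Pi^{\mathsf P}_k$ if its complement is in $\Sigma^{\mathsf P}_k$. Then, for each of the two languages $\mathcal L_\circ$ and $\mathcal L_\triangle$: 1. deciding, given a BD abduction problem $\mathbb P$ and a term $\sigma$, whether $\sigma$ is a theory-minimal solution of $\mathbb P$ is in $\Pi^{\mathsf P}_2$; 2. deciding, given $\mathbb P=\langle\Gamma,\psi,\mathsf H\rangle$ and $h\in\mathsf H$, whether $h$ is relevant with respect to theory-minimal solutions, i.e. occurs as a conjunct in at least one of them, is in $\Sigma^{\mathsf P}_3$; 3. deciding, given $\mathbb P=\langle\Gamma,\psi,\mathsf H\rangle$ and $h\in\mathsf H$, whether $h$ is necessary with respect to theory-minimal solutions, i.e. occurs as a conjunct in every one of them, is in $\Pi^{\mathsf P}_3$. -/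

import Mathlib

/-! ## The polynomial hierarchy over Mathlib's multi-stack Turing machines -/

namespace PolyHierarchy

open Classical in
/-- The predicate `R` on `α` is decided in deterministic polynomial time, instances being written
over the alphabet `A` by `enc`: a Turing machine outputs the truth value of `R a` on input `enc a`
within a number of steps bounded by a polynomial in the length of `enc a`. -/
def PolyTimeDecidable {α A : Type} (enc : α → List A) (R : α → Prop) : Prop :=
  Nonempty (Turing.TM2ComputableInPolyTime enc Computability.encodeBool (fun a => decide (R a)))

/-- The input tape `x # y₁ # ⋯ # yₖ` holding a word `x` over `A` and `k` binary words; the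
separator `#` is `Sum.inr none`. -/
def encodeTuple {A : Type} {k : ℕ} (a : List A × (Fin k → List Bool)) :
    List (A ⊕ Option Bool) :=
  a.1.map Sum.inl ++
    (List.ofFn a.2).flatMap (fun y => Sum.inr none :: y.map (fun b => Sum.inr (some b)))

/-- `k` alternating quantifiers over binary words of length at most `n`, in front of `R`. The first
quantifier is existential if the flag is `true`, and universal if it is `false`. -/
def altQuant (n : ℕ) : (k : ℕ) → Bool → ((Fin k → List Bool) → Prop) → Prop
  | 0, _, R => R Fin.elim0
  | k + 1, true, R =>
      ∃ y : List Bool, y.length ≤ n ∧ altQuant n k false (fun ys => R (Fin.cons y ys))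
  | k + 1, false, R =>
      ∀ y : List Bool, y.length ≤ n → altQuant n k true (fun ys => R (Fin.cons y ys))

/-- The class `Σₖᴾ`: `x ∈ L ↔ ∃ y₁ ∀ y₂ ∃ y₃ ⋯ Q yₖ, R (x, y₁, …, yₖ)` for a polynomial-time
decidable `R`, the quantifiers ranging over binary words of length at most `p |x|`, for a
polynomial `p`. -/
def InSigmaP (k : ℕ) {A : Type} (L : Set (List A)) : Prop :=
  ∃ (p : Polynomial ℕ) (R : List A × (Fin k → List Bool) → Prop),
    PolyTimeDecidable encodeTuple R ∧
      ∀ x : List A, x ∈ L ↔ altQuant (p.eval x.length) k true (fun ys => R (x, ys))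

/-- The class `Πₖᴾ` of complements of languages in `Σₖᴾ`. -/
def InPiP (k : ℕ) {A : Type} (L : Set (List A)) : Prop :=
  InSigmaP k Lᶜ

end PolyHierarchy

/-! ## Belnap–Dunn logic with `∘` and `△` -/

namespace BDAbduction

/-- The four Belnapian values: true, both, neither, false. -/
inductive Four
  | T | B | N | F
  deriving DecidableEq

namespace Four

/-- Values that are at least true. -/
def Designated (a : Four) : Prop := a = T ∨ a = B

def neg : Four → Four
  | T => F
  | B => B
  | N => N
  | F => T

def conj : Four → Four → Four
  | T, b => b
  | F, _ => F
  | B, T => B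
  | B, B => B
  | B, N => F
  | B, F => F
  | N, T => N
  | N, B => F
  | N, N => N
  | N, F => F

def disj : Four → Four → Four
  | T, _ => T
  | F, b => b
  | B, T => T
  | B, B => B
  | B, N => T
  | B, F => B
  | N, T => T
  | N, B => T
  | N, N => N
  | N, F => N

def circ : Four → Four
  | T => T
  | B => F
  | N => F
  | F => T

def tri : Four → Four
  | T => T
  | B => T
  | N => F
  | F => F

end Four

/-- Formulas over `¬, ∧, ∨, ∘, △`; the propositional variables are indexed by `ℕ`. -/
inductive Formula
  | var (p : ℕ)
  | neg (φ : Formula)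
  | conj (φ χ : Formula)
  | disj (φ χ : Formula)
  | circ (φ : Formula)
  | tri (φ : Formula)
  deriving DecidableEq

namespace Formula

/-- The shorthand `•φ` for `¬∘φ`. -/
def bullet (φ : Formula) : Formula := neg (circ φ)

/-- The value of a formula under a valuation of the variables. -/
def val (v : ℕ → Four) : Formula → Four
  | var p => v p
  | neg φ => (val v φ).neg
  | conj φ χ => (val v φ).conj (val v χ)
  | disj φ χ => (val v φ).disj (val v χ)
  | circ φ => (val v φ).circ
  | tri φ => (val v φ).tri

/-- Formulas of the fragment `L_BD` over `¬, ∧, ∨`. -/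
def IsBD : Formula → Prop
  | var _ => True
  | neg φ => IsBD φ
  | conj φ χ => IsBD φ ∧ IsBD χ
  | disj φ χ => IsBD φ ∧ IsBD χ
  | circ _ => False
  | tri _ => False

end Formula

/-- Entailment: preservation of the designated values under all valuations. -/
def Entails (Γ : Set Formula) (χ : Formula) : Prop :=
  ∀ v : ℕ → Four, (∀ φ ∈ Γ, (φ.val v).Designated) → (χ.val v).Designated

/-- The two languages in which solutions are sought. -/
inductive Lang
  | circ
  | tri
  deriving DecidableEq

/-- The constant falsum of the language: `•∘p`, respectively `△p ∧ ¬△p`. -/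
def Lang.bot : Lang → Formula
  | .circ => .bullet (.circ (.var 0))
  | .tri => .conj (.tri (.var 0)) (.neg (.tri (.var 0)))

/-- Atomic `∘`-literals `p, ¬p, ∘p, •p` and `△`-literals `p, ¬p, △p, ¬△p, △¬p, ¬△¬p`. -/
inductive Literal
  | pos (p : ℕ)
  | neg (p : ℕ)
  | circ (p : ℕ)
  | bullet (p : ℕ)
  | tri (p : ℕ)
  | negTri (p : ℕ)
  | triNeg (p : ℕ)
  | negTriNeg (p : ℕ)
  deriving DecidableEq

namespace Literal

def toFormula : Literal → Formula
  | pos p => .var p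
  | neg p => .neg (.var p)
  | circ p => .circ (.var p)
  | bullet p => .bullet (.var p)
  | tri p => .tri (.var p)
  | negTri p => .neg (.tri (.var p))
  | triNeg p => .tri (.neg (.var p))
  | negTriNeg p => .neg (.tri (.neg (.var p)))

/-- The literals of the given language. -/
def InLang : Lang → Literal → Prop
  | _, pos _ => True
  | _, neg _ => True
  | .circ, circ _ => True
  | .circ, bullet _ => True
  | .tri, tri _ => True
  | .tri, negTri _ => True
  | .tri, triNeg _ => True
  | .tri, negTriNeg _ => True
  | _, _ => False

end Literal

/-- A term is a (nonempty) conjunction of literals, given by the list of its conjuncts. -/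
structure Term where
  first : Literal
  rest : List Literal

namespace Term

def lits (τ : Term) : List Literal := τ.first :: τ.rest

def toFormula (τ : Term) : Formula :=
  τ.rest.foldl (fun φ l => φ.conj l.toFormula) τ.first.toFormula

end Term

/-- An abduction problem `⟨Γ, ψ, H⟩`: a finite theory `Γ ⊆ L_BD`, an observation `ψ ∈ L_BD` with
`Γ ⊭ ψ`, and a finite set `H` of hypotheses, which are literals. -/
structure Problem where
  theory : List Formula
  observation : Formula
  hypotheses : List Literal
  theory_isBD : ∀ φ ∈ theory, φ.IsBD
  observation_isBD : observation.IsBD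
  not_entails : ¬ Entails {φ | φ ∈ theory} observation

namespace Problem

/-- `Γ, τ ⊨ χ`, where `Γ` is the theory of the problem. -/
def EntailsWith (P : Problem) (τ : Term) (χ : Formula) : Prop :=
  Entails ({φ | φ ∈ P.theory} ∪ {τ.toFormula}) χ

/-- `τ` is a solution of `P` in the language `ℓ`. -/
def IsSolution (ℓ : Lang) (P : Problem) (τ : Term) : Prop :=
  (∀ l ∈ τ.lits, l.InLang ℓ ∧ l ∈ P.hypotheses) ∧
    P.EntailsWith τ P.observation ∧ ¬ P.EntailsWith τ ℓ.bot

def IsProperSolution (ℓ : Lang) (P : Problem) (τ : Term) : Prop :=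
  P.IsSolution ℓ τ ∧ ¬ Entails {τ.toFormula} P.observation

def IsTheoryMinimal (ℓ : Lang) (P : Problem) (τ : Term) : Prop :=
  P.IsProperSolution ℓ τ ∧
    ¬ ∃ φ : Term, P.IsProperSolution ℓ φ ∧
      ¬ P.EntailsWith φ τ.toFormula ∧ P.EntailsWith τ φ.toFormula

/-- The hypothesis `h` occurs in some theory-minimal solution. -/
def IsRelevant (ℓ : Lang) (P : Problem) (h : Literal) : Prop :=
  ∃ τ : Term, P.IsTheoryMinimal ℓ τ ∧ h ∈ τ.lits

/-- The hypothesis `h` occurs in every theory-minimal solution. -/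
def IsNecessary (ℓ : Lang) (P : Problem) (h : Literal) : Prop :=
  ∀ τ : Term, P.IsTheoryMinimal ℓ τ → h ∈ τ.lits

end Problem

/-! ## Instances as words -/

/-- The symbols in which instances are written: `var` opens a variable and is followed by the
binary digits of its index; `thy`, `obs`, `hyp` and `qry` open a formula of the theory, the
observation, a hypothesis, and a literal of the query. -/
inductive Sym
  | var
  | bit (b : Bool)
  | neg
  | conj
  | disj
  | circ
  | tri
  | thy
  | obs
  | hyp
  | qry
  deriving DecidableEq, Fintype

/-- Polish notation, with variables in binary. -/
def Formula.encode : Formula → List Sym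
  | var p => Sym.var :: (Computability.encodeNat p).map Sym.bit
  | neg φ => Sym.neg :: φ.encode
  | conj φ χ => Sym.conj :: (φ.encode ++ χ.encode)
  | disj φ χ => Sym.disj :: (φ.encode ++ χ.encode)
  | circ φ => Sym.circ :: φ.encode
  | tri φ => Sym.tri :: φ.encode

def Problem.encode (P : Problem) : List Sym :=
  P.theory.flatMap (fun φ => Sym.thy :: φ.encode) ++
    (Sym.obs :: P.observation.encode) ++
    P.hypotheses.flatMap (fun l => Sym.hyp :: l.toFormula.encode)

/-- A problem together with a list of literals (the conjuncts of a term, or one hypothesis). -/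
def encodeInstance (P : Problem) (ls : List Literal) : List Sym :=
  P.encode ++ ls.flatMap (fun l => Sym.qry :: l.toFormula.encode)

/-! The encoding is unambiguous. -/

theorem bits_cancel {a b : List Bool} {s t : List Sym}
    (hs : ∀ c s', s ≠ Sym.bit c :: s') (ht : ∀ c t', t ≠ Sym.bit c :: t')
    (h : a.map Sym.bit ++ s = b.map Sym.bit ++ t) : a = b ∧ s = t := by
  induction a generalizing b with
  | nil =>
    cases b with
    | nil => simpa using h
    | cons c b => exact absurd h (hs c _)
  | cons c a ih =>
    cases b with
    | nil => exact absurd h.symm (ht c _)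
    | cons d b =>
      simp only [List.map_cons, List.cons_append, List.cons.injEq, Sym.bit.injEq] at h
      obtain ⟨h1, h2⟩ := ih h.2
      exact ⟨by rw [h.1, h1], h2⟩

theorem Formula.encode_ne_bit (φ : Formula) (s : List Sym) (c : Bool) (s' : List Sym) :
    φ.encode ++ s ≠ Sym.bit c :: s' := by
  cases φ <;> simp [Formula.encode]

theorem Formula.encode_cancel {φ χ : Formula} {s t : List Sym}
    (hs : ∀ c s', s ≠ Sym.bit c :: s') (ht : ∀ c t', t ≠ Sym.bit c :: t')
    (h : φ.encode ++ s = χ.encode ++ t) : φ = χ ∧ s = t := by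
  induction φ generalizing χ s t with
  | var p =>
    cases χ <;> simp only [Formula.encode, List.cons_append, List.cons.injEq, reduceCtorEq,
      false_and, true_and] at h
    obtain ⟨h1, h2⟩ := bits_cancel hs ht h
    have h3 := congrArg Computability.decodeNat h1
    rw [Computability.decode_encodeNat, Computability.decode_encodeNat] at h3
    exact ⟨by rw [h3], h2⟩
  | neg φ ih | circ φ ih | tri φ ih =>
    cases χ <;> simp only [Formula.encode, List.cons_append, List.cons.injEq, reduceCtorEq,
      false_and, true_and] at h
    obtain ⟨h1, h2⟩ := ih hs ht h
    exact ⟨by rw [h1], h2⟩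
  | conj φ₁ φ₂ ih₁ ih₂ | disj φ₁ φ₂ ih₁ ih₂ =>
    cases χ <;> simp only [Formula.encode, List.cons_append, List.cons.injEq, reduceCtorEq,
      false_and, true_and, List.append_assoc] at h
    obtain ⟨h1, h2⟩ := ih₁ (encode_ne_bit _ _) (encode_ne_bit _ _) h
    obtain ⟨h3, h4⟩ := ih₂ hs ht h2
    exact ⟨by rw [h1, h3], h4⟩

theorem Literal.toFormula_injective : Function.Injective Literal.toFormula := by
  intro a b h
  cases a <;> cases b <;> simp_all [Literal.toFormula, Formula.bullet]

/-- A list of blocks, each opened by the marker `m`, followed by a word that does not begin with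
`m` or a binary digit, can be read back. -/
theorem blocks_cancel {α : Type} {f : α → Formula} (hf : Function.Injective f) {m : Sym}
    (hm : ∀ c, m ≠ Sym.bit c) {a b : List α} {s t : List Sym}
    (hs : ∀ c s', s ≠ Sym.bit c :: s') (ht : ∀ c t', t ≠ Sym.bit c :: t')
    (hs' : ∀ s', s ≠ m :: s') (ht' : ∀ t', t ≠ m :: t')
    (h : a.flatMap (fun x => m :: (f x).encode) ++ s
      = b.flatMap (fun x => m :: (f x).encode) ++ t) : a = b ∧ s = t := by
  have key : ∀ (l : List α) (u : List Sym), (∀ c u', u ≠ Sym.bit c :: u') →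
      ∀ c u', l.flatMap (fun x => m :: (f x).encode) ++ u ≠ Sym.bit c :: u' := by
    intro l u hu c u' e
    cases l with
    | nil => exact hu c u' e
    | cons x l =>
      simp only [List.flatMap_cons, List.cons_append, List.cons.injEq] at e
      exact hm c e.1
  induction a generalizing b with
  | nil =>
    cases b with
    | nil => exact ⟨rfl, h⟩
    | cons y b => exact absurd h (by simpa using hs' _)
  | cons x a ih =>
    cases b with
    | nil => exact absurd h.symm (by simpa using ht' _)
    | cons y b =>
      simp only [List.flatMap_cons, List.cons_append, List.cons.injEq, List.append_assoc,
        true_and] at h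
      obtain ⟨h1, h2⟩ := Formula.encode_cancel (key a s hs) (key b t ht) h
      obtain ⟨h3, h4⟩ := ih h2
      exact ⟨by rw [hf h1, h3], h4⟩

theorem encodeInstance_injective {P Q : Problem} {ls ks : List Literal}
    (h : encodeInstance P ls = encodeInstance Q ks) : P = Q ∧ ls = ks := by
  have q0 : ∀ (l : List Literal) (m : Sym), m ≠ Sym.qry → ∀ s',
      l.flatMap (fun l => Sym.qry :: l.toFormula.encode) ≠ m :: s' := by
    intro l m hm s' e
    cases l with
    | nil => simp at e
    | cons x l => simp only [List.flatMap_cons, List.cons_append, List.cons.injEq] at e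
                  exact hm e.1.symm
  have q1 : ∀ (l k : List Literal) (m : Sym), m ≠ Sym.qry → m ≠ Sym.hyp → ∀ s',
      l.flatMap (fun l => Sym.hyp :: l.toFormula.encode) ++
        k.flatMap (fun l => Sym.qry :: l.toFormula.encode) ≠ m :: s' := by
    intro l k m hm hm' s' e
    cases l with
    | nil => exact q0 k m hm s' e
    | cons x l => simp only [List.flatMap_cons, List.cons_append, List.cons.injEq] at e
                  exact hm' e.1.symm
  simp only [encodeInstance, Problem.encode, List.append_assoc, List.cons_append] at h
  obtain ⟨h1, h2⟩ := blocks_cancel (f := id) Function.injective_id (by simp) (by simp) (by simp)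
    (by simp) (by simp) h
  simp only [List.cons.injEq, true_and] at h2
  obtain ⟨h3, h4⟩ := Formula.encode_cancel (fun c => q1 _ _ _ (by simp) (by simp))
    (fun c => q1 _ _ _ (by simp) (by simp)) h2
  obtain ⟨h5, h6⟩ := blocks_cancel Literal.toFormula_injective (by simp)
    (fun c => q0 _ _ (by simp)) (fun c => q0 _ _ (by simp)) (q0 _ _ (by simp))
    (q0 _ _ (by simp)) h4
  have h7 := blocks_cancel (s := []) (t := []) Literal.toFormula_injective (m := Sym.qry)
    (by simp) (by simp) (by simp) (by simp) (by simp) (by simpa using h6)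
  refine ⟨?_, h7.1⟩
  cases P
  cases Q
  simp_all

/-! ## The decision problems, as languages -/

/-- Given a problem and a term, is the term a theory-minimal solution in the language `ℓ`? -/
def theoryMinimalRecognition (ℓ : Lang) : Set (List Sym) :=
  {w | ∃ (P : Problem) (σ : Term), w = encodeInstance P σ.lits ∧ P.IsTheoryMinimal ℓ σ}

/-- Given a problem and a hypothesis, does it occur in some theory-minimal solution? -/
def theoryMinimalRelevance (ℓ : Lang) : Set (List Sym) :=
  {w | ∃ (P : Problem) (h : Literal), w = encodeInstance P [h] ∧ h ∈ P.hypotheses ∧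
    P.IsRelevant ℓ h}

/-- Given a problem and a hypothesis, does it occur in every theory-minimal solution? -/
def theoryMinimalNecessity (ℓ : Lang) : Set (List Sym) :=
  {w | ∃ (P : Problem) (h : Literal), w = encodeInstance P [h] ∧ h ∈ P.hypotheses ∧
    P.IsNecessary ℓ h}

end BDAbduction

/-! The three problems are put in prenex form, with quantifiers over objects that are given variable
by variable. Only the set of conjuncts of a term matters, and both a set of literals and a valuation
are functions from variables to a finite set. Guessing a term together with a few valuations is
therefore guessing a single function `ℕ → Cell`.

Theory-minimality of τ says that τ is a proper solution and that every competitor φ is not a proper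
solution, or is not entailed by Γ, τ, or entails τ over Γ. Entailments are universal and
non-entailments existential in a valuation, and all universal choices, including φ, can be moved in
front of the existential ones. This gives the form ∀∃ (`minimal_iff_matrix`, `theoryMinimal_iff`).
Guessing τ first gives ∃∀∃ for relevance; "every τ is not minimal or contains h" gives ∀∃∀ for
necessity. The condition Γ ⊭ ψ on instances is existential and fits into these prefixes.

What remains is to decide the matrix in polynomial time. Read from right to left, Polish notation is
evaluated with a stack in a finite algebra, and the matrix depends only on the finite set of values
of the blocks, which `collector` gathers in its state. Any such `BlockAutomaton` is carried out by
one multi-stack machine that takes the functions as certificates and looks each variable up when it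
occurs (`polyTimeDecidable_relation`). Every binary word is a certificate of some function, and
every function agrees, on the variables of the instance, with one whose certificate is linear in the
length of the instance (`exists_lookup_eq`). So quantifiers over short words amount to quantifiers
over functions (`altQuant_iff_altFun`), and `inSigmaP_of_automaton` collects all this. The Π classes
follow by negating the prefix (`not_altFun`). -/

namespace BDAbduction

open Computability

/-! ## Reading words over a finite algebra -/

/-- The symbols that open a block. -/
inductive Marker
  | thy
  | obs
  | hyp
  | qry
  deriving DecidableEq

instance : Fintype Marker := ⟨{.thy, .obs, .hyp, .qry}, fun m => by cases m <;> simp⟩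

/-- The symbol in the alphabet of instances. -/
def Marker.sym : Marker → Sym
  | thy => .thy
  | obs => .obs
  | hyp => .hyp
  | qry => .qry

/-- The word made of a list of blocks, i.e. of formulas opened by markers. -/
def encodeBlocks (bs : List (Marker × Formula)) : List Sym :=
  bs.flatMap fun b => b.1.sym :: b.2.encode

theorem encodeBlocks_cons (b : Marker × Formula) (bs : List (Marker × Formula)) :
    encodeBlocks (b :: bs) = b.1.sym :: (b.2.encode ++ encodeBlocks bs) := rfl

/-- An automaton that evaluates formulas in an algebra `A`, given values of the variables in `V`,
and runs through the values of the blocks, from right to left, with states in `Q`. -/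
structure BlockAutomaton (V A Q : Type) where
  var : V → A
  neg : A → A
  conj : A → A → A
  disj : A → A → A
  circ : A → A
  tri : A → A
  init : Q
  step : Marker → A → Q → Q

namespace BlockAutomaton

variable {V A Q : Type} (M : BlockAutomaton V A Q)

/-- The value of a formula in the algebra. -/
def eval (f : ℕ → V) : Formula → A
  | .var p => M.var (f p)
  | .neg φ => M.neg (eval f φ)
  | .conj φ χ => M.conj (eval f φ) (eval f χ)
  | .disj φ χ => M.disj (eval f φ) (eval f χ)
  | .circ φ => M.circ (eval f φ)
  | .tri φ => M.tri (eval f φ)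

/-- The state reached after all blocks. -/
def result (f : ℕ → V) (bs : List (Marker × Formula)) : Q :=
  bs.foldr (fun b q => M.step b.1 (M.eval f b.2) q) M.init

/-- The effect of one symbol on the state, the stack of values, and the digits read so far, words
being read from right to left and variables being looked up by `look`. -/
def readSym (look : List Bool → V) : Sym → Q × List A × List Bool → Option (Q × List A × List Bool)
  | .bit b, (q, s, d) => if d = [] ∧ b = false then none else some (q, s, b :: d)
  | .var, (q, s, d) => some (q, M.var (look d) :: s, [])
  | .neg, (q, a :: s, []) => some (q, M.neg a :: s, [])
  | .circ, (q, a :: s, []) => some (q, M.circ a :: s, [])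
  | .tri, (q, a :: s, []) => some (q, M.tri a :: s, [])
  | .conj, (q, a :: b :: s, []) => some (q, M.conj a b :: s, [])
  | .disj, (q, a :: b :: s, []) => some (q, M.disj a b :: s, [])
  | .thy, (q, [a], []) => some (M.step .thy a q, [], [])
  | .obs, (q, [a], []) => some (M.step .obs a q, [], [])
  | .hyp, (q, [a], []) => some (M.step .hyp a q, [], [])
  | .qry, (q, [a], []) => some (M.step .qry a q, [], [])
  | _, _ => none

/-- The final state after reading a word from left to right, starting from a given configuration;
`none` unless both the stack and the list of digits are empty at the end. -/
def run (look : List Bool → V) : List Sym → Q × List A × List Bool → Option Q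
  | [], (q, s, d) => if s = [] ∧ d = [] then some q else none
  | c :: w, st => (M.readSym look c st).bind (run look w)

/-- The configuration after reading a word from right to left. -/
def readAll (look : List Bool → V) : List Sym → Option (Q × List A × List Bool)
  | [] => some (M.init, [], [])
  | c :: w => (readAll look w).bind (M.readSym look c)

/-- The final state after reading a word from right to left. -/
def read (look : List Bool → V) (x : List Sym) : Option Q :=
  M.run look x.reverse (M.init, [], [])

/-- The machine consumes the word iteratively from its last symbol; `readAll` is the same
computation as a structural recursion, which suits induction on formulas and blocks. -/
theorem read_eq (look : List Bool → V) (x : List Sym) :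
    M.read look x = (M.readAll look x).bind (M.run look []) := by
  have key : ∀ (x w : List Sym), M.run look (x.reverse ++ w) (M.init, [], []) =
      (M.readAll look x).bind (M.run look w) := by
    intro x
    induction x with
    | nil => intro w; rfl
    | cons c x ih =>
      intro w
      rw [List.reverse_cons, List.append_assoc, ih, readAll, Option.bind_assoc]
      rfl
  simpa [read] using key x []

variable {M}

/-- Numerals have their least significant digit first, so the last digit is read first, and
`readSym` refuses a superfluous zero there; this is the condition on `getLast`. -/
theorem readAll_bits {look : List Bool → V} {w : List Sym} {q : Q} {s : List A}
    (h : M.readAll look w = some (q, s, [])) :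
    ∀ d : List Bool, (∀ hd : d ≠ [], d.getLast hd = true) →
      M.readAll look (d.map Sym.bit ++ w) = some (q, s, d) := by
  intro d
  induction d with
  | nil => intro _; simpa using h
  | cons b d ih =>
    intro hd
    have h1 : M.readAll look (d.map Sym.bit ++ w) = some (q, s, d) := by
      apply ih
      intro hne
      have := hd (by simp)
      rwa [List.getLast_cons hne] at this
    have h2 : ¬ (d = [] ∧ b = false) := by
      rintro ⟨rfl, rfl⟩
      simpa using hd (by simp)
    simp [readAll, h1, readSym, h2]

theorem encodePosNum_getLast (n : PosNum) :
    (encodePosNum n).getLast (encodePosNum_nonempty n) = true := by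
  induction n with
  | one => rfl
  | bit0 n ih | bit1 n ih =>
    simp only [encodePosNum]
    rw [List.getLast_cons (encodePosNum_nonempty n)]
    exact ih

theorem encodeNat_getLast (n : ℕ) (h : encodeNat n ≠ []) : (encodeNat n).getLast h = true := by
  have key : ∀ (m : Num) (h : encodeNum m ≠ []), (encodeNum m).getLast h = true := by
    intro m h
    cases m with
    | zero => exact absurd rfl h
    | pos m => exact encodePosNum_getLast m
  exact key _ h

/-- When a connective is met from the right, its operands have already been evaluated and lie on top
of the stack, the left one uppermost. -/
theorem readAll_encode (look : List Bool → V) (φ : Formula) :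
    ∀ {w : List Sym} {q : Q} {s : List A}, M.readAll look w = some (q, s, []) →
      M.readAll look (φ.encode ++ w) =
        some (q, M.eval (fun p => look (encodeNat p)) φ :: s, []) := by
  induction φ with
  | var p =>
    intro w q s h
    simp [Formula.encode, readAll, readAll_bits h _ (encodeNat_getLast p), readSym, eval]
  | neg φ ih | circ φ ih | tri φ ih =>
    intro w q s h
    simp [Formula.encode, readAll, ih h, readSym, eval]
  | conj φ χ ih₁ ih₂ | disj φ χ ih₁ ih₂ =>
    intro w q s h
    simp [Formula.encode, readAll, ih₁ (ih₂ h), readSym, eval]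

theorem readAll_encodeBlocks (look : List Bool → V) (bs : List (Marker × Formula)) :
    M.readAll look (encodeBlocks bs) =
      some (M.result (fun p => look (encodeNat p)) bs, [], []) := by
  induction bs with
  | nil => rfl
  | cons b bs ih =>
    obtain ⟨m, φ⟩ := b
    have := readAll_encode look φ ih
    rw [encodeBlocks_cons, readAll, this]
    cases m <;> rfl

theorem read_encodeBlocks (look : List Bool → V) (bs : List (Marker × Formula)) :
    M.read look (encodeBlocks bs) = some (M.result (fun p => look (encodeNat p)) bs) := by
  rw [read_eq, readAll_encodeBlocks]
  simp [run]

/-- The new digit becomes the least significant one, so the numeral stays canonical, except when a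
zero is put before the empty numeral of `0`. -/
theorem exists_encodeNat_cons (p : ℕ) (b : Bool) (h : ¬ (encodeNat p = [] ∧ b = false)) :
    ∃ p', b :: encodeNat p = encodeNat p' := by
  have aux : ∀ n : Num, encodeNat (n : ℕ) = encodeNum n := fun n => by
    simp [encodeNat]
  unfold encodeNat at h ⊢
  cases hn : (p : Num) with
  | zero =>
    cases b with
    | false => simp [hn, encodeNum] at h
    | true => exact ⟨1, by simp [encodeNum]; rfl⟩
  | pos m =>
    cases b with
    | false => exact ⟨((Num.pos (PosNum.bit0 m) : Num) : ℕ), by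
        rw [← encodeNat, aux]; rfl⟩
    | true => exact ⟨((Num.pos (PosNum.bit1 m) : Num) : ℕ), by
        rw [← encodeNat, aux]; rfl⟩

/-- The invariant of the reader: the pending digits are a canonical numeral, each entry of the stack
stands for one complete formula, and everything further right consists of complete blocks. -/
theorem readAll_sound (look : List Bool → V) (x : List Sym) :
    ∀ {q : Q} {s : List A} {d : List Bool}, M.readAll look x = some (q, s, d) →
      ∃ (p : ℕ) (fs : List Formula) (bs : List (Marker × Formula)),
        d = encodeNat p ∧ s.length = fs.length ∧
        x = d.map Sym.bit ++ (fs.flatMap Formula.encode ++ encodeBlocks bs) := by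
  have h0 : encodeNat 0 = [] := rfl
  induction x with
  | nil =>
    intro q s d h
    simp only [readAll, Option.some.injEq, Prod.mk.injEq] at h
    obtain ⟨-, rfl, rfl⟩ := h
    exact ⟨0, [], [], rfl, rfl, rfl⟩
  | cons c x ih =>
    intro q s d h
    rw [readAll, Option.bind_eq_some_iff] at h
    obtain ⟨⟨q', s', d'⟩, h1, h2⟩ := h
    obtain ⟨p, fs, bs, hd, hs, hx⟩ := ih h1
    cases c with
    | bit b =>
      simp only [readSym] at h2
      split_ifs at h2 with hb
      simp only [Option.some.injEq, Prod.mk.injEq] at h2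
      obtain ⟨-, rfl, rfl⟩ := h2
      rw [hd] at hb
      obtain ⟨p', hp'⟩ := exists_encodeNat_cons p b hb
      exact ⟨p', fs, bs, by rw [hd, hp'], hs, by simp [hx]⟩
    | var =>
      simp only [readSym, Option.some.injEq, Prod.mk.injEq] at h2
      obtain ⟨-, rfl, rfl⟩ := h2
      exact ⟨0, .var p :: fs, bs, rfl, by simp [hs], by simp [hx, hd, Formula.encode]⟩
    | neg | circ | tri =>
      rcases s' with _ | ⟨a, s'⟩ <;> rcases d' with _ | ⟨b, d'⟩ <;>
        simp only [readSym, reduceCtorEq, Option.some.injEq, Prod.mk.injEq] at h2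
      obtain ⟨-, rfl, rfl⟩ := h2
      rcases fs with _ | ⟨φ, fs⟩
      · simp at hs
      · solve
        | refine ⟨0, .neg φ :: fs, bs, rfl, by simpa using hs, ?_⟩; simp [hx, Formula.encode]
        | refine ⟨0, .circ φ :: fs, bs, rfl, by simpa using hs, ?_⟩; simp [hx, Formula.encode]
        | refine ⟨0, .tri φ :: fs, bs, rfl, by simpa using hs, ?_⟩; simp [hx, Formula.encode]
    | conj | disj =>
      rcases s' with _ | ⟨a, _ | ⟨a', s'⟩⟩ <;> rcases d' with _ | ⟨b, d'⟩ <;>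
        simp only [readSym, reduceCtorEq, Option.some.injEq, Prod.mk.injEq] at h2
      obtain ⟨-, rfl, rfl⟩ := h2
      rcases fs with _ | ⟨φ, _ | ⟨χ, fs⟩⟩
      · simp at hs
      · simp at hs
      · solve
        | refine ⟨0, .conj φ χ :: fs, bs, rfl, by simpa using hs, ?_⟩; simp [hx, Formula.encode]
        | refine ⟨0, .disj φ χ :: fs, bs, rfl, by simpa using hs, ?_⟩; simp [hx, Formula.encode]
    | thy | obs | hyp | qry =>
      rcases s' with _ | ⟨a, _ | ⟨a', s'⟩⟩ <;> rcases d' with _ | ⟨b, d'⟩ <;>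
        simp only [readSym, reduceCtorEq, Option.some.injEq, Prod.mk.injEq] at h2
      obtain ⟨-, rfl, rfl⟩ := h2
      rcases fs with _ | ⟨φ, _ | ⟨χ, fs⟩⟩
      · simp at hs
      · solve
        | refine ⟨0, [], (.thy, φ) :: bs, rfl, rfl, ?_⟩; simp [hx, encodeBlocks, Marker.sym]
        | refine ⟨0, [], (.obs, φ) :: bs, rfl, rfl, ?_⟩; simp [hx, encodeBlocks, Marker.sym]
        | refine ⟨0, [], (.hyp, φ) :: bs, rfl, rfl, ?_⟩; simp [hx, encodeBlocks, Marker.sym]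
        | refine ⟨0, [], (.qry, φ) :: bs, rfl, rfl, ?_⟩; simp [hx, encodeBlocks, Marker.sym]
      · simp at hs

/-- Rejection of a malformed word does not depend on `look`, so on such words certificates and
functions trivially give the same answer. -/
theorem read_eq_none (look : List Bool → V) (x : List Sym)
    (h : ¬ ∃ bs, x = encodeBlocks bs) : M.read look x = none := by
  rw [read_eq]
  rcases hr : M.readAll look x with _ | ⟨q, s, d⟩
  · rfl
  · obtain ⟨p, fs, bs, hd, hs, hx⟩ := readAll_sound look x hr
    simp only [Option.bind_some, run, ite_eq_right_iff, reduceCtorEq, imp_false]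
    rintro ⟨rfl, rfl⟩
    rcases fs with _ | ⟨φ, fs⟩
    · exact h ⟨bs, by simpa using hx⟩
    · simp at hs

end BlockAutomaton

/-! ## Certificates as finite functions -/

section Lookup

variable {W : Type} {n : ℕ} (tok : Fin (n + 1) → Bool ⊕ W)

/-- One step in looking up `key` in a certificate. The certificate is a sequence of instructions in
unary: the instruction `inl b` compares the next digit of the key with `b`, and the instruction
`inr w` sets the value to `w` if the key has been matched, and returns to the beginning of the key.
The components are the number of the instruction, the rest of the key (`none` after a mismatch),
and the value. -/
def lookupStep (key : List Bool) : Fin (n + 1) × Option (List Bool) × W → Bool →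
    Fin (n + 1) × Option (List Bool) × W
  | (c, r, w), true => (c + 1, r, w)
  | (c, r, w), false =>
    match tok c with
    | .inl b => (0, if r.bind List.head? = some b then r.map List.tail else none, w)
    | .inr w' => (0, some key, if r = some [] then w' else w)

/-- The value of the key in a certificate. -/
def lookup [Inhabited W] (y : List Bool) (key : List Bool) : W :=
  (y.foldl (lookupStep tok key) (0, some key, default)).2.2

variable {tok}

theorem foldl_lookupStep_replicate (key : List Bool) (i : ℕ) (c : Fin (n + 1))
    (r : Option (List Bool)) (w : W) :
    (List.replicate i true).foldl (lookupStep tok key) (c, r, w) =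
      (c + (Fin.ofNat (n + 1) i), r, w) := by
  induction i generalizing c with
  | zero => simp
  | succ i ih =>
    rw [List.replicate_succ, List.foldl_cons, lookupStep, ih]
    congr 1
    ext
    simp [Fin.val_add]
    ring_nf

variable (n) in
/-- The unary code of an instruction. -/
def instruction (i : Fin (n + 1)) : List Bool := List.replicate i true ++ [false]

theorem foldl_lookupStep_instruction (key : List Bool) (i : Fin (n + 1))
    (r : Option (List Bool)) (w : W) :
    (instruction n i).foldl (lookupStep tok key) (0, r, w) =
      lookupStep tok key (i, r, w) false := by
  rw [instruction, List.foldl_append, foldl_lookupStep_replicate]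
  simp

/-- A mismatch persists until the next value instruction, so a series of comparisons tests whether
its digits are a prefix of the rest of the key. -/
theorem foldl_lookupStep_digits (inst : Bool ⊕ W → Fin (n + 1)) (hinst : ∀ t, tok (inst t) = t)
    (key : List Bool) (w : W) (d : List Bool) (r : List Bool) :
    (d.flatMap fun b => instruction n (inst (.inl b))).foldl (lookupStep tok key)
      (0, some r, w) = (0, if d <+: r then some (r.drop d.length) else none, w) := by
  have hnone : ∀ d : List Bool, (d.flatMap fun b => instruction n (inst (.inl b))).foldl
      (lookupStep tok key) (0, none, w) = (0, none, w) := by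
    intro d
    induction d with
    | nil => rfl
    | cons b d ih =>
      rw [List.flatMap_cons, List.foldl_append, foldl_lookupStep_instruction]
      simpa [lookupStep, hinst] using ih
  induction d generalizing r with
  | nil => simp
  | cons b d ih =>
    rw [List.flatMap_cons, List.foldl_append, foldl_lookupStep_instruction]
    simp only [lookupStep, hinst]
    cases r with
    | nil => simpa using hnone d
    | cons b' r =>
      by_cases hb : b' = b
      · subst hb
        simpa [List.cons_prefix_cons] using ih r
      · simp [hb, List.cons_prefix_cons, Ne.symm hb, hnone]

/-- The value is written only when nothing of the key is left, which sharpens "prefix" to equality.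
-/
theorem foldl_lookupStep_entry (inst : Bool ⊕ W → Fin (n + 1)) (hinst : ∀ t, tok (inst t) = t)
    (key : List Bool) (w w' : W) (d : List Bool) :
    ((d.flatMap fun b => instruction n (inst (.inl b))) ++ instruction n (inst (.inr w'))).foldl
      (lookupStep tok key) (0, some key, w) = (0, some key, if d = key then w' else w) := by
  rw [List.foldl_append, foldl_lookupStep_digits inst hinst, foldl_lookupStep_instruction]
  simp only [lookupStep, hinst]
  congr 3
  apply propext
  constructor
  · intro h
    split_ifs at h with hp
    obtain ⟨t, rfl⟩ := hp
    simp at h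
    simp [h]
  · rintro rfl
    simp

variable (tok) in
/-- Every function is the lookup function of a short certificate, on any finite set of keys. -/
theorem exists_lookup_eq [Inhabited W] (htok : Function.Surjective tok) (f : List Bool → W)
    (S : List (List Bool)) :
    ∃ y : List Bool, y.length ≤ (n + 1) * (S.map fun d => d.length + 1).sum ∧
      ∀ d ∈ S, lookup tok y d = f d := by
  obtain ⟨inst, hinst⟩ := htok.hasRightInverse
  have hinst : ∀ t, tok (inst t) = t := hinst
  set entry : List Bool → List Bool := fun d =>
    (d.flatMap fun b => instruction n (inst (.inl b))) ++ instruction n (inst (.inr (f d)))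
    with hentry
  have hlen : ∀ i : Fin (n + 1), (instruction n i).length ≤ n + 1 := fun i => by
    simp [instruction, i.is_le]
  -- The entry for `d` has `d.length + 1` instructions, each of at most `n + 1` digits in unary.
  refine ⟨S.flatMap entry, ?_, ?_⟩
  · have h1 : ∀ d : List Bool, (d.flatMap fun b => instruction n (inst (.inl b))).length ≤
        (n + 1) * d.length := by
      intro d
      induction d with
      | nil => simp
      | cons b d ih =>
        rw [List.flatMap_cons, List.length_append, List.length_cons]
        linarith [hlen (inst (.inl b))]
    induction S with
    | nil => simp
    | cons d S ih =>
      have h2 := h1 d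
      have h3 := hlen (inst (.inr (f d)))
      have h4 : (entry d).length ≤ (n + 1) * (d.length + 1) := by
        simp only [hentry, List.length_append]
        linarith
      simp only [List.flatMap_cons, List.length_append, List.map_cons, List.sum_cons]
      linarith
  · intro key hkey
    -- Repeated keys are harmless: all matching entries write the same value `f key`.
    have : ∀ (S : List (List Bool)) (w : W), (S.flatMap entry).foldl (lookupStep tok key)
        (0, some key, w) = (0, some key, if key ∈ S then f key else w) := by
      intro S
      induction S with
      | nil => simp
      | cons d S ih =>
        intro w
        rw [List.flatMap_cons, List.foldl_append, foldl_lookupStep_entry inst hinst, ih]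
        by_cases hd : d = key
        · subst hd; simp
        · simp [hd, Ne.symm hd]
    rw [lookup, this, if_pos hkey]

end Lookup

end BDAbduction

namespace BDAbduction

open Computability Turing StateTransition

/-! ## The machine -/

namespace Evaluator

/-- The stacks of the machine. -/
inductive Stk
  | inp
  | word
  | aux
  | key
  | key'
  | vals
  | out
  deriving DecidableEq

instance : Fintype Stk :=
  ⟨{.inp, .word, .aux, .key, .key', .vals, .out}, fun k => by cases k <;> simp⟩

/-- The labels of the machine. -/
inductive Label
  | load
  | main
  | digit
  | unary
  | binary
  | block
  | verdict
  | scan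
  | rewind
  | restore
  | clear
  | finish
  deriving DecidableEq

instance : Fintype Label :=
  ⟨{.load, .main, .digit, .unary, .binary, .block, .verdict, .scan, .rewind, .restore, .clear,
    .finish}, fun k => by cases k <;> simp⟩

/-- The alphabets of the stacks. -/
abbrev Alphabet (A : Type) : Stk → Type
  | .inp => Sym ⊕ Option Bool
  | .word => Sym
  | .aux => Sym ⊕ Option Bool
  | .key => Bool
  | .key' => Bool
  | .vals => A
  | .out => Bool

/-- The registers of the machine. -/
@[ext] structure Reg (m n : ℕ) (W A Q : Type) where
  q : Option Q
  sym : Option Sym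
  inp : Option (Sym ⊕ Option Bool)
  bit : Option Bool
  fst : Option A
  snd : Option A
  blk : Fin (m + 1)
  cnt : Fin (n + 1)
  alive : Bool
  res : Fin (m + 1) → W
  more : Bool

instance {m n : ℕ} {W A Q : Type} [Finite W] [Finite A] [Finite Q] : Finite (Reg m n W A Q) :=
  Finite.of_injective
    (fun r => (r.q, r.sym, r.inp, r.bit, r.fst, r.snd, r.blk, r.cnt, r.alive, r.res, r.more))
    fun r s h => by
      simp only [Prod.mk.injEq] at h
      ext1 <;> tauto

variable {m n : ℕ} {W A Q : Type} [Inhabited W]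

/-- The registers between two symbols of the word. -/
def Reg.idle (m n : ℕ) {W A Q : Type} [Inhabited W] (q : Option Q) : Reg m n W A Q :=
  -- The certificate number is `-1`, so that the first separator makes it `0`.
  ⟨q, none, none, none, none, none, -1, 0, true, default, false⟩

/-- The contents of the stacks. -/
def tapes (i : List (Sym ⊕ Option Bool)) (x : List Sym) (j : List (Sym ⊕ Option Bool))
    (d d' : List Bool) (s : List A) (o : List Bool) : ∀ k, List (Alphabet A k)
  | .inp => i
  | .word => x
  | .aux => j
  | .key => d
  | .key' => d'
  | .vals => s
  | .out => o

section update

variable (i i' : List (Sym ⊕ Option Bool)) (x x' : List Sym) (j j' : List (Sym ⊕ Option Bool))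
    (d e d' e' : List Bool) (s s' : List A) (o o' : List Bool)

@[simp] theorem update_inp : Function.update (tapes i x j d d' s o) Stk.inp i' =
    tapes i' x j d d' s o := by funext k; cases k <;> rfl

@[simp] theorem update_word : Function.update (tapes i x j d d' s o) Stk.word x' =
    tapes i x' j d d' s o := by funext k; cases k <;> rfl

@[simp] theorem update_aux : Function.update (tapes i x j d d' s o) Stk.aux j' =
    tapes i x j' d d' s o := by funext k; cases k <;> rfl

@[simp] theorem update_key : Function.update (tapes i x j d d' s o) Stk.key e =
    tapes i x j e d' s o := by funext k; cases k <;> rfl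

@[simp] theorem update_key' : Function.update (tapes i x j d d' s o) Stk.key' e' =
    tapes i x j d e' s o := by funext k; cases k <;> rfl

@[simp] theorem update_vals : Function.update (tapes i x j d d' s o) Stk.vals s' =
    tapes i x j d d' s' o := by funext k; cases k <;> rfl

@[simp] theorem update_out : Function.update (tapes i x j d d' s o) Stk.out o' =
    tapes i x j d d' s o' := by funext k; cases k <;> rfl

@[simp] theorem stacks_inp : tapes i x j d d' s o Stk.inp = i := rfl
@[simp] theorem stacks_word : tapes i x j d d' s o Stk.word = x := rfl
@[simp] theorem stacks_aux : tapes i x j d d' s o Stk.aux = j := rfl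
@[simp] theorem stacks_key : tapes i x j d d' s o Stk.key = d := rfl
@[simp] theorem stacks_key' : tapes i x j d d' s o Stk.key' = d' := rfl
@[simp] theorem stacks_vals : tapes i x j d d' s o Stk.vals = s := rfl
@[simp] theorem stacks_out : tapes i x j d d' s o Stk.out = o := rfl

end update

section program

open TM2.Stmt

variable (M : BlockAutomaton (Fin (m + 1) → W) A Q) (tok : Fin (n + 1) → Bool ⊕ W)
  (acc : Option Q → Bool)

/-- The type of statements of the machine. -/
abbrev Stmt (m n : ℕ) (W A Q : Type) := TM2.Stmt (Alphabet A) Label (Reg m n W A Q)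

/-- Go on with the given label, in the given state. -/
def continueAt (l : Label) (q : Reg m n W A Q → Option Q) : Stmt m n W A Q :=
  load (fun r => Reg.idle m n (q r)) (goto fun _ => l)

/-- The operation of a unary connective. -/
def unaryOp : Option Sym → A → A
  | some .neg, a => M.neg a
  | some .circ, a => M.circ a
  | some .tri, a => M.tri a
  | _, a => a

/-- The operation of a binary connective. -/
def binaryOp : Option Sym → A → A → A
  | some .conj, a, b => M.conj a b
  | some .disj, a, b => M.disj a b
  | _, a, _ => a

/-- The transition at a marker. -/
def blockOp : Option Sym → A → Q → Q
  | some .thy, a, q => M.step .thy a q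
  | some .obs, a, q => M.step .obs a q
  | some .hyp, a, q => M.step .hyp a q
  | some .qry, a, q => M.step .qry a q
  | _, _, q => q

/-- The label that handles a symbol of the word. -/
def handler : Option Sym → Label
  | none => .verdict
  | some (.bit _) => .digit
  | some .var => .scan
  | some .neg => .unary
  | some .circ => .unary
  | some .tri => .unary
  | some .conj => .binary
  | some .disj => .binary
  | some .thy => .block
  | some .obs => .block
  | some .hyp => .block
  | some .qry => .block

/-- The digit carried by a symbol. -/
def bitOf : Option Sym → Bool
  | some (.bit b) => b
  | _ => false

/-- The registers after an instruction that sets the value. -/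
def setValue (r : Reg m n W A Q) : Reg m n W A Q :=
  { r with
    res := Function.update r.res r.blk
      (match tok r.cnt with
        | .inr w => if r.alive = true ∧ r.bit = none then w else r.res r.blk
        | .inl _ => r.res r.blk)
    cnt := 0
    alive := true
    inp := none
    bit := none }

/-- The registers at the beginning of a certificate. -/
def nextCertificate (r : Reg m n W A Q) : Reg m n W A Q :=
  { r with
    res := Function.update r.res (r.blk + 1) default
    blk := r.blk + 1
    cnt := 0
    alive := true
    inp := none
    bit := none }

/-- The program of the machine. -/
def program [DecidableEq W] : Label → Stmt m n W A Q
  -- Moving the word to its own stack reverses it, so its last symbol comes out first, as the reader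
  -- requires. The separator that ends the word is put back.
  | .load =>
    pop Stk.inp (fun r c => { r with inp := c }) <|
    branch (fun r => (r.inp.getD (.inr none)).isLeft)
      (push Stk.word (fun r => (r.inp.getD (.inr none)).elim id fun _ => Sym.var) <|
        continueAt .load fun r => r.q)
      (push Stk.inp (fun r => r.inp.getD (.inr none)) <| continueAt .main fun r => r.q)
  | .main =>
    pop Stk.word (fun r c => { r with sym := c }) <|
    peek Stk.key (fun r c => { r with bit := c }) <|
    goto fun r => handler r.sym
  | .digit =>
    branch (fun r => r.bit.isNone && !bitOf r.sym) (continueAt .finish fun _ => none) <|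
    push Stk.key (fun r => bitOf r.sym) <|
    continueAt .main fun r => r.q
  | .unary =>
    branch (fun r => r.bit.isSome) (continueAt .finish fun _ => none) <|
    pop Stk.vals (fun r a => { r with fst := a }) <|
    branch (fun r => r.fst.isSome)
      (push Stk.vals (fun r => unaryOp M r.sym (r.fst.getD (M.var default))) <|
        continueAt .main fun r => r.q)
      (continueAt .finish fun _ => none)
  | .binary =>
    branch (fun r => r.bit.isSome) (continueAt .finish fun _ => none) <|
    pop Stk.vals (fun r a => { r with fst := a }) <|
    pop Stk.vals (fun r a => { r with snd := a }) <|
    branch (fun r => r.fst.isSome && r.snd.isSome)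
      (push Stk.vals (fun r => binaryOp M r.sym (r.fst.getD (M.var default))
          (r.snd.getD (M.var default))) <|
        continueAt .main fun r => r.q)
      (continueAt .finish fun _ => none)
  | .block =>
    branch (fun r => r.bit.isSome) (continueAt .finish fun _ => none) <|
    pop Stk.vals (fun r a => { r with fst := a }) <|
    pop Stk.vals (fun r a => { r with snd := a }) <|
    branch (fun r => r.fst.isSome && r.snd.isNone)
      (continueAt .main fun r => r.q.map (blockOp M r.sym (r.fst.getD (M.var default))))
      (continueAt .finish fun _ => none)
  | .verdict =>
    peek Stk.vals (fun r a => { r with fst := a }) <|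
    continueAt .finish fun r => if r.bit.isSome || r.fst.isSome then none else r.q
  -- A single pass looks the key up in all certificates in turn. Symbols read are saved on `aux`, to
  -- restore the input afterwards, and matched digits on `key'`, to rewind the key.
  | .scan =>
    pop Stk.inp (fun r c => { r with inp := c }) <|
    peek Stk.key (fun r c => { r with bit := c }) <|
    branch (fun r => r.inp.isNone)
      (load (fun r => { r with bit := none }) <| goto fun _ => .restore) <|
    push Stk.aux (fun r => r.inp.getD (.inr none)) <|
    branch (fun r => r.inp = some (.inr (some true)))
      (load (fun r => { r with inp := none, bit := none, cnt := r.cnt + 1 }) <|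
        goto fun _ => .scan) <|
    branch (fun r => r.inp = some (.inr (some false)))
      (branch (fun r => (tok r.cnt).isRight)
        (load (setValue tok) <| goto fun _ => .rewind) <|
      branch (fun r => r.alive && r.bit.isSome && tok r.cnt = .inl (r.bit.getD false))
        (push Stk.key' (fun r => r.bit.getD false) <|
          pop Stk.key (fun r _ => { r with inp := none, bit := none, cnt := 0 }) <|
          goto fun _ => .scan)
        (load (fun r => { r with inp := none, bit := none, cnt := 0, alive := false }) <|
          goto fun _ => .scan)) <|
    load nextCertificate <| goto fun _ => .rewind
  | .rewind =>
    pop Stk.key' (fun r c => { r with bit := c }) <|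
    branch (fun r => r.bit.isSome)
      (push Stk.key (fun r => r.bit.getD false) <|
        load (fun r => { r with bit := none }) <| goto fun _ => .rewind) <|
    goto fun _ => .scan
  | .restore =>
    pop Stk.aux (fun r c => { r with inp := c }) <|
    branch (fun r => r.inp.isSome)
      (push Stk.inp (fun r => r.inp.getD (.inr none)) <|
        load (fun r => { r with inp := none }) <| goto fun _ => .restore) <|
    goto fun _ => .clear
  | .clear =>
    pop Stk.key (fun r c => { r with bit := c }) <|
    pop Stk.key' (fun r c => { r with bit := if r.bit.isSome then r.bit else c }) <|
    branch (fun r => r.bit.isSome)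
      (load (fun r => { r with bit := none }) <| goto fun _ => .clear) <|
    push Stk.vals (fun r => M.var r.res) <|
    continueAt .main fun r => r.q
  -- A proper halting configuration has only the output stack nonempty and the registers in their
  -- initial state; `aux` and `key'` are already empty at this label.
  | .finish =>
    pop Stk.inp (fun r c => { r with more := c.isSome }) <|
    pop Stk.word (fun r c => { r with more := r.more || c.isSome }) <|
    pop Stk.key (fun r c => { r with more := r.more || c.isSome }) <|
    pop Stk.vals (fun r c => { r with more := r.more || c.isSome }) <|
    branch (fun r => r.more) (goto fun _ => .finish) <|
    push Stk.out (fun r => acc r.q) <|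
    load (fun _ => Reg.idle m n (some M.init)) halt

end program

/-! ### Running times of the simple loops of the machine -/

variable (M : BlockAutomaton (Fin (m + 1) → W) A Q) (tok : Fin (n + 1) → Bool ⊕ W)
  (acc : Option Q → Bool) [DecidableEq W]

/-- The type of configurations of the machine. -/
abbrev Config (m n : ℕ) (W A Q : Type) := TM2.Cfg (Alphabet A) Label (Reg m n W A Q)

/-- The machine leads from one configuration to another in at most `t` steps. -/
def ReachesIn (t : ℕ) (a b : Config m n W A Q) : Prop :=
  Nonempty (EvalsToInTime (TM2.step (program M tok acc)) a (some b) t)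

variable {M tok acc}

theorem ReachesIn.refl (a : Config m n W A Q) : ReachesIn M tok acc 0 a a :=
  ⟨EvalsToInTime.refl _ _⟩

theorem ReachesIn.trans {s t : ℕ} {a b c : Config m n W A Q} (h₁ : ReachesIn M tok acc s a b)
    (h₂ : ReachesIn M tok acc t b c) : ReachesIn M tok acc (s + t) a c := by
  obtain ⟨h₁⟩ := h₁
  obtain ⟨h₂⟩ := h₂
  rw [add_comm]
  exact ⟨h₁.trans _ _ _ _ _ _ h₂⟩

theorem ReachesIn.mono {s t : ℕ} {a b : Config m n W A Q} (h : ReachesIn M tok acc s a b)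
    (hst : s ≤ t) : ReachesIn M tok acc t a b := by
  obtain ⟨h⟩ := h
  exact ⟨⟨h.toEvalsTo, h.steps_le_m.trans hst⟩⟩

theorem ReachesIn.head {t : ℕ} {a b c : Config m n W A Q}
    (h₁ : TM2.step (program M tok acc) a = some b) (h₂ : ReachesIn M tok acc t b c) :
    ReachesIn M tok acc (t + 1) a c := by
  rw [add_comm]
  exact ReachesIn.trans (b := b) ⟨⟨⟨1, h₁⟩, le_rfl⟩⟩ h₂

/-- Emptying the stacks and writing the output. -/
theorem reachesIn_finish (N : ℕ) : ∀ (i : List (Sym ⊕ Option Bool)) (x : List Sym) (d : List Bool)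
    (s : List A) (r : Reg m n W A Q), i.length ≤ N → x.length ≤ N → d.length ≤ N → s.length ≤ N →
    ReachesIn M tok acc (N + 1) ⟨some .finish, r, tapes i x [] d [] s []⟩
      ⟨none, Reg.idle m n (some M.init), tapes [] [] [] [] [] [] [acc r.q]⟩ := by
  have hend : ∀ r : Reg m n W A Q, ReachesIn M tok acc 1
      ⟨some .finish, r, tapes [] [] [] [] [] [] []⟩
      ⟨none, Reg.idle m n (some M.init), tapes [] [] [] [] [] [] [acc r.q]⟩ := by
    intro r
    refine ReachesIn.head (b := _) ?_ (ReachesIn.refl _)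
    simp [program]
  induction N with
  | zero =>
    intro i x d s r hi hx hd hs
    simp only [Nat.le_zero, List.length_eq_zero_iff] at hi hx hd hs
    subst hi hx hd hs
    exact hend r
  | succ N ih =>
    intro i x d s r hi hx hd hs
    by_cases h : (((i.head?.isSome || x.head?.isSome) || d.head?.isSome) || s.head?.isSome) = true
    · refine ReachesIn.head (b := ⟨some .finish, { r with more := true },
        tapes i.tail x.tail [] d.tail [] s.tail []⟩) ?_ (ih _ _ _ _ _ ?_ ?_ ?_ ?_)
      · simp only [program, TM2.step, TM2.stepAux, stacks_inp, stacks_word, stacks_key,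
          stacks_vals, update_inp, update_word, update_key, update_vals, h, cond_true]
      all_goals simp only [List.length_tail]; omega
    · simp only [Bool.or_eq_true, not_or, Bool.not_eq_true, Option.isSome_eq_false_iff,
        Option.isNone_iff_eq_none, List.head?_eq_none_iff] at h
      obtain ⟨⟨⟨rfl, rfl⟩, rfl⟩, rfl⟩ := h
      exact (hend r).mono (by omega)

theorem reachesIn_load (t : List (Option Bool)) (x : List Sym) : ∀ (x' : List Sym) (q : Option Q),
    ReachesIn M tok acc (x.length + 1)
      ⟨some .load, Reg.idle m n q,
        tapes (x.map Sum.inl ++ (none :: t).map Sum.inr) x' [] [] [] [] []⟩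
      ⟨some .main, Reg.idle m n q,
        tapes ((none :: t).map Sum.inr) (x.reverse ++ x') [] [] [] [] []⟩ := by
  induction x with
  | nil =>
    intro x' q
    refine ReachesIn.head (b := _) ?_ (ReachesIn.refl _)
    simp [program, continueAt, Reg.idle]
  | cons c x ih =>
    intro x' q
    refine ReachesIn.head (b := _) ?_ ((ih (c :: x') q).mono le_rfl |> fun h => by
      simpa using h)
    simp [program, continueAt, Reg.idle]

theorem reachesIn_rewind (r : Reg m n W A Q) (hr : r.bit = none) (i j : List (Sym ⊕ Option Bool))
    (x : List Sym) (s : List A) : ∀ d' d : List Bool,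
    ReachesIn M tok acc (d'.length + 1) ⟨some .rewind, r, tapes i x j d d' s []⟩
      ⟨some .scan, r, tapes i x j (d'.reverse ++ d) [] s []⟩ := by
  have hr' : { r with bit := none } = r := by rw [← hr]
  intro d'
  induction d' with
  | nil =>
    intro d
    refine ReachesIn.head (b := _) ?_ (ReachesIn.refl _)
    simp [program, hr', hr]
  | cons b d' ih =>
    intro d
    refine ReachesIn.head (b := ⟨some .rewind, r, tapes i x j (b :: d) d' s []⟩) ?_ ?_
    · simp [program, hr']
    · simpa using ih (b :: d)

theorem reachesIn_restore (r : Reg m n W A Q) (hr : r.inp = none) (d d' : List Bool) (x : List Sym)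
    (s : List A) : ∀ j i : List (Sym ⊕ Option Bool),
    ReachesIn M tok acc (j.length + 1) ⟨some .restore, r, tapes i x j d d' s []⟩
      ⟨some .clear, r, tapes (j.reverse ++ i) x [] d d' s []⟩ := by
  have hr' : { r with inp := none } = r := by rw [← hr]
  intro j
  induction j with
  | nil =>
    intro i
    refine ReachesIn.head (b := _) ?_ (ReachesIn.refl _)
    simp [program, hr', hr]
  | cons b j ih =>
    intro i
    refine ReachesIn.head (b := ⟨some .restore, r, tapes (b :: i) x j d d' s []⟩) ?_ ?_
    · simp [program, hr']
    · simpa using ih (b :: i)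

/-- Both key stacks lose a digit at each step, so a common bound on their lengths gives the time.
Only `q` and `res` matter, since the other registers are reset. -/
theorem reachesIn_clear (r : Reg m n W A Q) (i : List (Sym ⊕ Option Bool)) (x : List Sym)
    (s : List A) (N : ℕ) : ∀ (r' : Reg m n W A Q) (d d' : List Bool), r'.q = r.q → r'.res = r.res →
    d.length ≤ N → d'.length ≤ N →
    ReachesIn M tok acc (N + 1) ⟨some .clear, r', tapes i x [] d d' s []⟩
      ⟨some .main, Reg.idle m n r.q, tapes i x [] [] [] (M.var r.res :: s) []⟩ := by
  have hend : ∀ r' : Reg m n W A Q, r'.q = r.q → r'.res = r.res → ReachesIn M tok acc 1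
      ⟨some .clear, r', tapes i x [] [] [] s []⟩
      ⟨some .main, Reg.idle m n r.q, tapes i x [] [] [] (M.var r.res :: s) []⟩ := by
    intro r' hq hres
    refine ReachesIn.head (b := _) ?_ (ReachesIn.refl _)
    simp [program, continueAt, hq, hres]
  induction N with
  | zero =>
    intro r' d d' hq hres hd hd'
    simp only [Nat.le_zero, List.length_eq_zero_iff] at hd hd'
    subst hd hd'
    exact hend r' hq hres
  | succ N ih =>
    intro r' d d' hq hres hd hd'
    by_cases h : d = [] ∧ d' = []
    · obtain ⟨rfl, rfl⟩ := h
      exact (hend r' hq hres).mono (by omega)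
    · refine ReachesIn.head (b := ⟨some .clear, { r' with bit := none },
        tapes i x [] d.tail d'.tail s []⟩) ?_ (ih _ _ _ ?_ ?_ ?_ ?_)
      · rcases d with _ | ⟨b, d⟩ <;> rcases d' with _ | ⟨b', d'⟩ <;> simp [program] at h ⊢
      · exact hq
      · exact hres
      all_goals simp only [List.length_tail]; omega

end Evaluator

end BDAbduction

/-! ### Simulation of lookups and of the reader, and the polynomial time bound -/

namespace BDAbduction

open Computability Turing StateTransition

namespace Evaluator

variable {m n : ℕ} {W A Q : Type} [Inhabited W]
variable {M : BlockAutomaton (Fin (m + 1) → W) A Q} {tok : Fin (n + 1) → Bool ⊕ W}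
  {acc : Option Q → Bool}

/-- The registers while a certificate is scanned, according to the state of the lookup. -/
def scanReg (r : Reg m n W A Q) (b : Fin (m + 1)) (st : Fin (n + 1) × Option (List Bool) × W)
    (res : Fin (m + 1) → W) : Reg m n W A Q :=
  { r with
    inp := none
    bit := none
    blk := b
    cnt := st.1
    alive := st.2.1.isSome
    res := Function.update res b st.2.2 }

/-- The stacks holding the key are split as required by the state of the lookup. -/
def Aligned (key : List Bool) (r : Option (List Bool)) (d d' : List Bool) : Prop :=
  d'.reverse ++ d = key ∧ ∀ d₀, r = some d₀ → d = d₀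

theorem Aligned.length_le {key : List Bool} {r : Option (List Bool)} {d d' : List Bool}
    (h : Aligned key r d d') : d'.length ≤ key.length := by
  rw [← h.1]; simp

/-- The values of a key in consecutive certificates. -/
def collect (tok : Fin (n + 1) → Bool ⊕ W) (key : List Bool) :
    List (List Bool) → Fin (m + 1) → (Fin (m + 1) → W) → Fin (m + 1) → W
  | [], _, res => res
  | y :: ys, b, res => collect tok key ys (b + 1) (Function.update res (b + 1) (lookup tok y key))

/-- Here `c` counts the certificates already processed. It is compared with `b + 1` modulo `m + 1`,
because `b` is the last one processed and starts at `-1`. -/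
theorem collect_apply (key : List Bool) (ys : List (List Bool)) : ∀ (b : Fin (m + 1)) (c : ℕ)
    (res : Fin (m + 1) → W) (k : Fin (m + 1)), b + 1 = Fin.ofNat (m + 1) c →
    c + ys.length = m + 1 →
    collect tok key ys b res k =
      if k.val < c then res k else lookup tok (ys.getD (k.val - c) []) key := by
  induction ys with
  | nil =>
    intro b c res k _ hc
    have : k.val < c := by simp at hc; omega
    simp [collect, this]
  | cons y ys ih =>
    intro b c res k hb hc
    simp only [List.length_cons] at hc
    have hcv : (Fin.ofNat (m + 1) c).val = c := by
      simp only [Fin.ofNat]; exact Nat.mod_eq_of_lt (by omega)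
    rw [collect, ih (b + 1) (c + 1) _ k ?_ (by omega)]
    · rcases lt_trichotomy k.val c with h | h | h
      · have hne : k ≠ b + 1 := by
          rintro rfl
          rw [hb, hcv] at h
          exact lt_irrefl _ h
        rw [if_pos (by omega), if_pos h, Function.update_of_ne hne]
      · have he : k = b + 1 := by
          rw [hb]; exact Fin.ext (by rw [hcv, h])
        rw [if_pos (by omega), if_neg (by omega), he, Function.update_self, ← he, h]
        simp
      · rw [if_neg (by omega), if_neg (by omega)]
        obtain ⟨k', hk'⟩ : ∃ k', k.val - c = k' + 1 := ⟨k.val - c - 1, by omega⟩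
        rw [hk', List.getD_cons_succ]
        congr 2
        omega
    · rw [hb]
      ext
      simp [Fin.val_add]

theorem collect_ofFn (key : List Bool) (ys : Fin (m + 1) → List Bool) (res : Fin (m + 1) → W) :
    collect tok key (List.ofFn ys) (-1) res = fun k => lookup tok (ys k) key := by
  funext k
  rw [collect_apply key _ (-1) 0 res k (by simp) (by simp)]
  simp [k.is_le, -List.ofFn_succ]

variable [DecidableEq W]

/-- More than one step is needed only at a value instruction, which rewinds the key in at most
`key.length + 1` further steps. After a mismatch the position in the key no longer matters, and
`Aligned` only asks that the two stacks still make up the key. -/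
theorem reachesIn_scan_bit (r : Reg m n W A Q) (b : Fin (m + 1)) (res : Fin (m + 1) → W)
    (i j : List (Sym ⊕ Option Bool)) (x : List Sym) (s : List A) (key : List Bool) (y : Bool)
    (st : Fin (n + 1) × Option (List Bool) × W) (d d' : List Bool) (h : Aligned key st.2.1 d d') :
    ∃ e e', Aligned key (lookupStep tok key st y).2.1 e e' ∧
      ReachesIn M tok acc (key.length + 2)
        ⟨some .scan, scanReg r b st res, tapes (.inr (some y) :: i) x j d d' s []⟩
        ⟨some .scan, scanReg r b (lookupStep tok key st y) res,
          tapes i x (.inr (some y) :: j) e e' s []⟩ := by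
  obtain ⟨c, o, w⟩ := st
  have hlen := h.length_le
  cases y with
  | true =>
    refine ⟨d, d', h, (ReachesIn.head (b := _) ?_ (ReachesIn.refl _)).mono (by omega)⟩
    simp [program, scanReg, lookupStep]
  | false =>
    rcases ht : tok c with y' | w'
    · by_cases hm : o.bind List.head? = some y'
      · obtain ⟨_ | ⟨z, o⟩, rfl, hz⟩ := Option.bind_eq_some_iff.1 hm
        · simp at hz
        · simp only [List.head?_cons, Option.some.injEq] at hz
          subst hz
          obtain ⟨h1, h2⟩ := h
          obtain rfl := h2 _ rfl
          refine ⟨o, z :: d', ⟨by simpa using h1, by simp [lookupStep, ht]⟩,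
            (ReachesIn.head (b := _) ?_ (ReachesIn.refl _)).mono (by omega)⟩
          simp [program, scanReg, lookupStep, ht]
      · refine ⟨d, d', ⟨h.1, by simp [lookupStep, ht, hm]⟩,
          (ReachesIn.head (b := _) ?_ (ReachesIn.refl _)).mono (by omega)⟩
        rcases o with _ | o
        · simp [program, scanReg, lookupStep, ht]
        · obtain rfl := h.2 _ rfl
          rcases d with _ | ⟨z, d⟩
          · simp [program, scanReg, lookupStep, ht]
          · have hz : ¬ z = y' := by simpa using hm
            have hz' : ¬ y' = z := fun e => hz e.symm
            simp [program, scanReg, lookupStep, ht, hz, hz']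
    · refine ⟨key, [], ⟨rfl, by simp [lookupStep, ht]⟩, ?_⟩
      refine (ReachesIn.head (b := _) ?_ (h.1 ▸ reachesIn_rewind _ ?_ i
        (.inr (some false) :: j) x s d' d)).mono (by omega)
      · rcases o with _ | o
        · simp [program, scanReg, lookupStep, ht, setValue]
        · obtain rfl := h.2 _ rfl
          simp [program, scanReg, lookupStep, ht, setValue]
      · rfl

theorem reachesIn_scan_bits (r : Reg m n W A Q) (b : Fin (m + 1)) (res : Fin (m + 1) → W)
    (i : List (Sym ⊕ Option Bool)) (x : List Sym) (s : List A) (key : List Bool) (y : List Bool) :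
    ∀ (st : Fin (n + 1) × Option (List Bool) × W) (j : List (Sym ⊕ Option Bool))
      (d d' : List Bool), Aligned key st.2.1 d d' →
    ∃ e e', Aligned key (y.foldl (lookupStep tok key) st).2.1 e e' ∧
      ReachesIn M tok acc (y.length * (key.length + 2))
        ⟨some .scan, scanReg r b st res,
          tapes (y.map (fun b => .inr (some b)) ++ i) x j d d' s []⟩
        ⟨some .scan, scanReg r b (y.foldl (lookupStep tok key) st) res,
          tapes i x ((y.map fun b => .inr (some b)).reverse ++ j) e e' s []⟩ := by
  induction y with
  | nil =>
    intro st j d d' h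
    exact ⟨d, d', h, by simpa using ReachesIn.refl _⟩
  | cons y ys ih =>
    intro st j d d' h
    obtain ⟨e₁, e₁', h₁, hr₁⟩ := reachesIn_scan_bit (M := M) (tok := tok) (acc := acc) r b res
      (ys.map (fun b => .inr (some b)) ++ i) j x s key y st d d' h
    obtain ⟨e₂, e₂', h₂, hr₂⟩ := ih _ (.inr (some y) :: j) _ _ h₁
    refine ⟨e₂, e₂', h₂, ?_⟩
    have := (hr₁.trans hr₂).mono
      (t := (y :: ys).length * (key.length + 2)) (by simp only [List.length_cons]; linarith)
    simpa using this

/-- The end of the input, holding the certificates. -/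
def certificates (ys : List (List Bool)) : List (Option Bool) :=
  ys.flatMap fun y => none :: y.map some

theorem reachesIn_scan (x : List Sym) (s : List A) (key : List Bool) (ys : List (List Bool)) :
    ∀ (r : Reg m n W A Q) (j : List (Sym ⊕ Option Bool)) (d d' : List Bool),
      d'.reverse ++ d = key →
    ∃ (r' : Reg m n W A Q) (e e' : List Bool), e'.reverse ++ e = key ∧ r'.q = r.q ∧
      r'.res = collect tok key ys r.blk r.res ∧
      ReachesIn M tok acc ((certificates ys).length * (key.length + 2))
        ⟨some .scan, r, tapes ((certificates ys).map .inr) x j d d' s []⟩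
        ⟨some .scan, r', tapes [] x (((certificates ys).map .inr).reverse ++ j) e e' s []⟩ := by
  induction ys with
  | nil =>
    intro r j d d' h
    exact ⟨r, d, d', h, rfl, rfl, by simpa [certificates] using ReachesIn.refl _⟩
  | cons y ys ih =>
    intro r j d d' h
    have hlen : d'.length ≤ key.length := by rw [← h]; simp
    have h₁ : ReachesIn M tok acc (key.length + 2)
        ⟨some .scan, r, tapes ((certificates (y :: ys)).map .inr) x j d d' s []⟩
        ⟨some .scan, scanReg r (r.blk + 1) (0, some key, default) r.res,
          tapes (y.map (fun b => .inr (some b)) ++ (certificates ys).map .inr) x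
            (.inr none :: j) key [] s []⟩ := by
      have hrw := reachesIn_rewind (M := M) (tok := tok) (acc := acc)
        (scanReg r (r.blk + 1) (0, some key, default) r.res) rfl
        (y.map (fun b => .inr (some b)) ++ (certificates ys).map .inr) (.inr none :: j) x s d' d
      rw [h] at hrw
      refine (ReachesIn.head (b := _) ?_ hrw).mono (by omega)
      simp [program, scanReg, nextCertificate, certificates, Function.comp_def]
    obtain ⟨e, e', he, h₂⟩ := reachesIn_scan_bits (M := M) (tok := tok) (acc := acc) r (r.blk + 1)
      r.res ((certificates ys).map .inr) x s key y (0, some key, default) (.inr none :: j) key []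
      ⟨rfl, by simp⟩
    obtain ⟨r', f, f', hf, hq, hres, h₃⟩ := ih
      (scanReg r (r.blk + 1) (y.foldl (lookupStep tok key) (0, some key, default)) r.res)
      ((y.map fun b => .inr (some b)).reverse ++ .inr none :: j) e e' he.1
    refine ⟨r', f, f', hf, hq, hres, ?_⟩
    have := ((h₁.trans h₂).trans h₃).mono
      (t := (certificates (y :: ys)).length * (key.length + 2)) (by
        simp only [certificates, List.flatMap_cons, List.length_append, List.length_cons,
          List.length_map]
        linarith)
    simpa [certificates, Function.comp_def] using this

/-- With `L` the length of the certificates and `K` that of the key, the time is `L * (K + 2)` for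
scanning, `1` for leaving the scan, `L + 1` for restoring the input and `K + 1` for clearing the
key. -/
theorem reachesIn_lookup (x : List Sym) (s : List A) (key : List Bool)
    (ys : Fin (m + 1) → List Bool) (r : Reg m n W A Q) (hr : r.blk = -1) :
    ReachesIn M tok acc ((certificates (List.ofFn ys)).length * (key.length + 3) + key.length + 3)
      ⟨some .scan, r, tapes ((certificates (List.ofFn ys)).map .inr) x [] key [] s []⟩
      ⟨some .main, Reg.idle m n r.q, tapes ((certificates (List.ofFn ys)).map .inr) x [] [] []
        (M.var (fun k => lookup tok (ys k) key) :: s) []⟩ := by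
  obtain ⟨r', e, e', he, hq, hres, h₁⟩ := reachesIn_scan (M := M) (tok := tok) (acc := acc) x s key
    (List.ofFn ys) r [] key [] rfl
  rw [hr, collect_ofFn] at hres
  have hlen : e.length ≤ key.length ∧ e'.length ≤ key.length := by
    rw [← he]; simp
  set L := (certificates (List.ofFn ys)).map (Sum.inr : _ → Sym ⊕ Option Bool) with hL
  have h₂ : ReachesIn M tok acc 1 ⟨some .scan, r', tapes [] x (L.reverse ++ []) e e' s []⟩
      ⟨some .restore, { r' with inp := none, bit := none },
        tapes [] x (L.reverse ++ []) e e' s []⟩ := by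
    refine ReachesIn.head (b := _) ?_ (ReachesIn.refl _)
    simp [program]
  have h₃ := reachesIn_restore (M := M) (tok := tok) (acc := acc)
    { r' with inp := none, bit := none } rfl e e' x s (L.reverse ++ []) []
  have h₄ := reachesIn_clear (M := M) (tok := tok) (acc := acc) r' L x s key.length
    { r' with inp := none, bit := none } e e' rfl rfl hlen.1 hlen.2
  rw [← hq, ← hres]
  simp only [List.append_nil, List.reverse_reverse] at h₁ h₂ h₃
  refine (((h₁.trans h₂).trans h₃).trans h₄).mono ?_
  simp only [hL, List.length_reverse, List.length_map]
  linarith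

/-- The input of the machine, after the word. -/
abbrev tail (ys : Fin (m + 1) → List Bool) : List (Sym ⊕ Option Bool) :=
  (certificates (List.ofFn ys)).map .inr

/-- A bound on the number of steps between two symbols of the word. -/
def roundTime (N L : ℕ) : ℕ := L * (N + 3) + N + 4

theorem step_main (ys : Fin (m + 1) → List Bool) (c : Sym) (w : List Sym) (q : Q)
    (s : List A) (d : List Bool) : TM2.step (program M tok acc)
      ⟨some .main, Reg.idle m n (some q), tapes (tail ys) (c :: w) [] d [] s []⟩ =
      some ⟨some (handler (some c)), { Reg.idle m n (some q) with
        sym := some c, bit := d.head? }, tapes (tail ys) w [] d [] s []⟩ := by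
  simp [program]

theorem reachesIn_readSym (ys : Fin (m + 1) → List Bool) (N : ℕ) (c : Sym) (w : List Sym) (q : Q)
    (s : List A) (d : List Bool) (hd : d.length ≤ N) (q' : Q) (s' : List A) (d' : List Bool)
    (h : M.readSym (fun key k => lookup tok (ys k) key) c (q, s, d) = some (q', s', d')) :
    ReachesIn M tok acc (roundTime N (certificates (List.ofFn ys)).length)
      ⟨some .main, Reg.idle m n (some q), tapes (tail ys) (c :: w) [] d [] s []⟩
      ⟨some .main, Reg.idle m n (some q'), tapes (tail ys) w [] d' [] s' []⟩ := by
  cases c with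
  | var =>
    simp only [BlockAutomaton.readSym, Option.some.injEq, Prod.mk.injEq] at h
    obtain ⟨rfl, rfl, rfl⟩ := h
    refine (ReachesIn.head (b := _) ?_ (reachesIn_lookup w s d ys
      { Reg.idle m n (some q) with sym := some .var, bit := d.head? } rfl)).mono ?_
    · simp [program, handler, -List.ofFn_succ]
    · unfold roundTime
      have := Nat.mul_le_mul_left (certificates (List.ofFn ys)).length
        (Nat.add_le_add_right hd 3)
      omega
  | bit b =>
    simp only [BlockAutomaton.readSym] at h
    split_ifs at h with hb
    simp only [Option.some.injEq, Prod.mk.injEq] at h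
    obtain ⟨rfl, rfl, rfl⟩ := h
    refine (ReachesIn.head (b := ⟨some .digit, { Reg.idle m n (some q) with
      sym := some (.bit b), bit := d.head? }, tapes (tail ys) w [] d [] s []⟩) ?_
      (ReachesIn.head (b := _) ?_ (ReachesIn.refl _))).mono (by unfold roundTime; omega)
    · simp [program, handler]
    · rcases d with _ | ⟨b', d⟩ <;> rcases b with _ | _ <;>
        simp [program, continueAt, bitOf, Reg.idle] at hb ⊢
  | neg | circ | tri =>
    rcases s with _ | ⟨a, s⟩ <;> rcases d with _ | ⟨b, d⟩ <;>
      simp only [BlockAutomaton.readSym, reduceCtorEq, Option.some.injEq, Prod.mk.injEq] at h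
    obtain ⟨rfl, rfl, rfl⟩ := h
    refine (ReachesIn.head (step_main ys _ w q _ _)
      (ReachesIn.head (b := _) ?_ (ReachesIn.refl _))).mono (by unfold roundTime; omega)
    simp [handler, program, continueAt, Reg.idle, unaryOp]
  | conj | disj =>
    rcases s with _ | ⟨a, _ | ⟨a', s⟩⟩ <;> rcases d with _ | ⟨b, d⟩ <;>
      simp only [BlockAutomaton.readSym, reduceCtorEq, Option.some.injEq, Prod.mk.injEq] at h
    obtain ⟨rfl, rfl, rfl⟩ := h
    refine (ReachesIn.head (step_main ys _ w q _ _)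
      (ReachesIn.head (b := _) ?_ (ReachesIn.refl _))).mono (by unfold roundTime; omega)
    simp [handler, program, continueAt, Reg.idle, binaryOp]
  | thy | obs | hyp | qry =>
    rcases s with _ | ⟨a, _ | ⟨a', s⟩⟩ <;> rcases d with _ | ⟨b, d⟩ <;>
      simp only [BlockAutomaton.readSym, reduceCtorEq, Option.some.injEq, Prod.mk.injEq] at h
    obtain ⟨rfl, rfl, rfl⟩ := h
    refine (ReachesIn.head (step_main ys _ w q _ _)
      (ReachesIn.head (b := _) ?_ (ReachesIn.refl _))).mono (by unfold roundTime; omega)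
    simp [handler, program, continueAt, Reg.idle, blockOp]

/-- Values may already have been popped when the failure is noticed, hence the possibly shorter
stack `s'`. -/
theorem reachesIn_readSym_none (ys : Fin (m + 1) → List Bool) (c : Sym) (w : List Sym) (q : Q)
    (s : List A) (d : List Bool)
    (h : M.readSym (fun key k => lookup tok (ys k) key) c (q, s, d) = none) :
    ∃ s' : List A, s'.length ≤ s.length ∧ ReachesIn M tok acc 2
      ⟨some .main, Reg.idle m n (some q), tapes (tail ys) (c :: w) [] d [] s []⟩
      ⟨some .finish, Reg.idle m n none, tapes (tail ys) w [] d [] s' []⟩ := by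
  cases c with
  | var => simp [BlockAutomaton.readSym] at h
  | bit b =>
    simp only [BlockAutomaton.readSym] at h
    split_ifs at h with hb
    obtain ⟨rfl, rfl⟩ := hb
    refine ⟨s, le_rfl,
      ReachesIn.head (step_main ys _ w q _ _)
        (ReachesIn.head (b := _) ?_ (ReachesIn.refl _))⟩
    simp [handler, program, continueAt, bitOf]
  | neg | circ | tri =>
    rcases d with _ | ⟨b, d⟩
    · rcases s with _ | ⟨a, s⟩
      · refine ⟨[], le_rfl,
          ReachesIn.head (step_main ys _ w q _ _)
            (ReachesIn.head (b := _) ?_ (ReachesIn.refl _))⟩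
        simp [handler, program, continueAt, Reg.idle]
      · simp [BlockAutomaton.readSym] at h
    · refine ⟨s, le_rfl,
        ReachesIn.head (step_main ys _ w q _ _)
          (ReachesIn.head (b := _) ?_ (ReachesIn.refl _))⟩
      simp [handler, program, continueAt]
  | conj | disj =>
    rcases d with _ | ⟨b, d⟩
    · rcases s with _ | ⟨a, _ | ⟨a', s⟩⟩
      · refine ⟨[], le_rfl,
          ReachesIn.head (step_main ys _ w q _ _)
            (ReachesIn.head (b := _) ?_ (ReachesIn.refl _))⟩
        simp [handler, program, continueAt, Reg.idle]
      · refine ⟨[], by simp,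
          ReachesIn.head (step_main ys _ w q _ _)
            (ReachesIn.head (b := _) ?_ (ReachesIn.refl _))⟩
        simp [handler, program, continueAt, Reg.idle]
      · simp [BlockAutomaton.readSym] at h
    · refine ⟨s, le_rfl,
        ReachesIn.head (step_main ys _ w q _ _)
          (ReachesIn.head (b := _) ?_ (ReachesIn.refl _))⟩
      simp [handler, program, continueAt]
  | thy | obs | hyp | qry =>
    rcases d with _ | ⟨b, d⟩
    · rcases s with _ | ⟨a, _ | ⟨a', s⟩⟩
      · refine ⟨[], le_rfl,
          ReachesIn.head (step_main ys _ w q _ _)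
            (ReachesIn.head (b := _) ?_ (ReachesIn.refl _))⟩
        simp [handler, program, continueAt, Reg.idle]
      · simp [BlockAutomaton.readSym] at h
      · refine ⟨s, by simp only [List.length_cons]; omega,
          ReachesIn.head (step_main ys _ w q _ _)
            (ReachesIn.head (b := _) ?_ (ReachesIn.refl _))⟩
        simp [handler, program, continueAt, Reg.idle]
    · refine ⟨s, le_rfl,
        ReachesIn.head (step_main ys _ w q _ _)
          (ReachesIn.head (b := _) ?_ (ReachesIn.refl _))⟩
      simp [handler, program, continueAt]

/-- This keeps the stacks within the length of the word, which bounds the cost of every lookup and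
of the final emptying. -/
theorem readSym_length {V : Type} {M : BlockAutomaton V A Q} {look : List Bool → V} {c : Sym}
    {q q' : Q} {s s' : List A} {d d' : List Bool}
    (h : M.readSym look c (q, s, d) = some (q', s', d')) :
    s'.length ≤ s.length + 1 ∧ d'.length ≤ d.length + 1 := by
  cases c <;> rcases d with _ | ⟨b, d⟩ <;> rcases s with _ | ⟨a, _ | ⟨a', s⟩⟩ <;>
    simp only [BlockAutomaton.readSym, Option.some.injEq, Prod.mk.injEq] at h <;>
    (try split_ifs at h) <;>
    (try simp only [reduceCtorEq, Option.some.injEq, Prod.mk.injEq] at h) <;>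
    obtain ⟨-, rfl, rfl⟩ := h <;> simp

/-- Each symbol read adds at most one entry to a stack, so the two sums bounded by `N` never grow.
The last summand of the time pays for two steps to reach `finish` and for emptying the stacks. -/
theorem reachesIn_run (ys : Fin (m + 1) → List Bool) (N : ℕ) (w : List Sym) :
    ∀ (q : Q) (s : List A) (d : List Bool), w.length + s.length ≤ N → w.length + d.length ≤ N →
    ReachesIn M tok acc (w.length * roundTime N (certificates (List.ofFn ys)).length +
        (N + (certificates (List.ofFn ys)).length + 3))
      ⟨some .main, Reg.idle m n (some q), tapes (tail ys) w [] d [] s []⟩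
      ⟨none, Reg.idle m n (some M.init), tapes [] [] [] [] [] []
        [acc (M.run (fun key k => lookup tok (ys k) key) w (q, s, d))]⟩ := by
  induction w with
  | nil =>
    intro q s d hs hd
    simp only [List.length_nil, zero_add] at hs hd
    have h₁ : ReachesIn M tok acc 2
        ⟨some .main, Reg.idle m n (some q), tapes (tail ys) [] [] d [] s []⟩
        ⟨some .finish, Reg.idle m n (M.run (fun key k => lookup tok (ys k) key) [] (q, s, d)),
          tapes (tail ys) [] [] d [] s []⟩ := by
      refine ReachesIn.head (b := ⟨some .verdict, { Reg.idle m n (some q) with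
        bit := d.head? }, tapes (tail ys) [] [] d [] s []⟩) ?_
        (ReachesIn.head (b := _) ?_ (ReachesIn.refl _))
      · simp [program, handler, Reg.idle]
      · rcases d with _ | ⟨b, d⟩ <;> rcases s with _ | ⟨a, s⟩ <;>
          simp [program, continueAt, Reg.idle, BlockAutomaton.run]
    refine (h₁.trans (reachesIn_finish (N + (certificates (List.ofFn ys)).length) _ _ _ _ _ ?_ ?_
      ?_ ?_)).mono (by omega)
    · simp
    · simp
    · omega
    · omega
  | cons c w ih =>
    intro q s d hs hd
    simp only [List.length_cons] at hs hd
    rw [BlockAutomaton.run]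
    rcases h : M.readSym (fun key k => lookup tok (ys k) key) c (q, s, d) with _ | ⟨q', s', d'⟩
    · obtain ⟨s', hs', h₁⟩ := reachesIn_readSym_none (acc := acc) ys c w q s d h
      refine (h₁.trans (reachesIn_finish (N + (certificates (List.ofFn ys)).length) _ _ _ _ _ ?_ ?_
        ?_ ?_)).mono (by omega)
      · simp
      · omega
      · omega
      · omega
    · have h₁ := reachesIn_readSym (acc := acc) ys N c w q s d (by omega) q' s' d' h
      have hl := readSym_length h
      refine (h₁.trans (ih q' s' d' (by omega) (by omega))).mono ?_
      simp only [List.length_cons]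
      linarith

/-- The machine, bundled. -/
noncomputable def machine (M : BlockAutomaton (Fin (m + 1) → W) A Q)
    (tok : Fin (n + 1) → Bool ⊕ W) (acc : Option Q → Bool) [Finite A] [Finite Q] [Finite W] :
    FinTM2 where
  K := Stk
  k₀ := .inp
  k₁ := .out
  Γ := Alphabet A
  Λ := Label
  main := .load
  σ := Reg m n W A Q
  initialState := Reg.idle m n (some M.init)
  σFin := Fintype.ofFinite _
  Γk₀Fin := inferInstanceAs (Fintype (Sym ⊕ Option Bool))
  m := program M tok acc

theorem outputs_of_reachesIn [Finite A] [Finite Q] [Finite W]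
    {l l' : List (Sym ⊕ Option Bool)} {o o' : List Bool} {t : ℕ}
    (h : ReachesIn M tok acc t ⟨some .load, Reg.idle m n (some M.init), tapes l [] [] [] [] [] []⟩
      ⟨none, Reg.idle m n (some M.init), tapes [] [] [] [] [] [] o⟩) (hl : l' = l) (ho : o' = o) :
    Nonempty (TM2OutputsInTime (machine M tok acc) l' (some o') t) := by
  subst hl ho
  have hinit : initList (machine M tok acc) l' =
      ⟨some .load, Reg.idle m n (some M.init), tapes l' [] [] [] [] [] []⟩ := by
    unfold initList
    congr 1
    funext k
    cases k <;> rfl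
  have hhalt : haltList (machine M tok acc) o' =
      ⟨none, Reg.idle m n (some M.init), tapes [] [] [] [] [] [] o'⟩ := by
    unfold haltList
    congr 1
    funext k
    cases k <;> rfl
  obtain ⟨h⟩ := h
  exact ⟨⟨⟨h.steps, (congrArg (fun c => (flip bind (machine M tok acc).step)^[h.steps] c)
    (congrArg some hinit)).trans (h.evals_in_steps.trans (congrArg some hhalt.symm))⟩,
    h.steps_le_m⟩⟩

variable (M) in
/-- The relation decided by the machine, between a word and a list of certificates. -/
def relation (tok : Fin (n + 1) → Bool ⊕ W) (acc : Option Q → Bool)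
    (a : List Sym × (Fin (m + 1) → List Bool)) : Prop :=
  acc (M.read (fun key k => lookup tok (a.2 k) key) a.1) = true

theorem polyTimeDecidable_relation [Finite A] [Finite Q] [Finite W] :
    PolyHierarchy.PolyTimeDecidable PolyHierarchy.encodeTuple (relation M tok acc) := by
  refine ⟨⟨⟨machine M tok acc, Equiv.refl _, Equiv.refl _⟩,
    -- One round per symbol, one pass over the certificates per round, at most one rewinding of the
    -- key per certificate symbol; the lengths of the word and of the certificates are both bounded
    -- by that of the input.
    .X * (.X * (.X + 3) + .X + 4) + 2 * .X + 4, ?_⟩⟩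
  rintro ⟨x, ys⟩
  classical
  have h₁ := reachesIn_load (M := M) (tok := tok) (acc := acc)
    ((certificates (List.ofFn ys)).tail) x [] (some M.init)
  -- There is at least one certificate, so the word is followed by a separator, at which loading
  -- stops.
  have hc : none :: (certificates (List.ofFn ys)).tail = certificates (List.ofFn ys) := by
    rw [List.ofFn_succ]
    rfl
  rw [hc, List.append_nil] at h₁
  have h₂ := reachesIn_run (M := M) (tok := tok) (acc := acc) ys x.length x.reverse M.init [] []
    (by simp) (by simp)
  have hinput : PolyHierarchy.encodeTuple (x, ys) =
      x.map Sum.inl ++ (certificates (List.ofFn ys)).map Sum.inr := by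
    simp [PolyHierarchy.encodeTuple, certificates, List.map_flatMap, Function.comp_def]
  have h₃ := h₁.trans h₂
  have hacc : acc (M.run (fun key k => lookup tok (ys k) key) x.reverse (M.init, [], [])) =
      decide (relation M tok acc (x, ys)) := by
    by_cases h : acc (M.run (fun key k => lookup tok (ys k) key) x.reverse (M.init, [], [])) <;>
      simp [relation, BlockAutomaton.read, h]
  rw [hacc] at h₃
  have htime : x.length + 1 + (x.reverse.length * roundTime x.length
      (certificates (List.ofFn ys)).length +
        (x.length + (certificates (List.ofFn ys)).length + 3)) ≤
      Polynomial.eval (PolyHierarchy.encodeTuple (x, ys)).length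
        (.X * (.X * (.X + 3) + .X + 4) + 2 * .X + 4 : Polynomial ℕ) := by
    simp only [hinput, List.length_append, List.length_map, List.length_reverse,
      Polynomial.eval_add, Polynomial.eval_mul, Polynomial.eval_X, Polynomial.eval_ofNat, roundTime]
    set a := x.length
    set b := (certificates (List.ofFn ys)).length
    have : a * (b * (a + 3) + a + 4) ≤ (a + b) * ((a + b) * (a + b + 3) + (a + b) + 4) := by
      gcongr <;> omega
    omega
  have h₄ := h₃.mono htime
  refine Classical.choice (outputs_of_reachesIn h₄ ?_ rfl)
  rw [hinput]
  exact List.map_id _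

end Evaluator

end BDAbduction

namespace BDAbduction

open Computability PolyHierarchy

/-! ## Alternating quantifiers over functions -/

section Quantifiers

variable {W : Type}

/-- `k` alternating quantifiers over functions from `ℕ` to `W`, the first one being existential if
the flag is `true`. -/
def altFun : (k : ℕ) → Bool → ((Fin k → ℕ → W) → Prop) → Prop
  | 0, _, R => R Fin.elim0
  | k + 1, true, R => ∃ f : ℕ → W, altFun k false fun fs => R (Fin.cons f fs)
  | k + 1, false, R => ∀ f : ℕ → W, altFun k true fun fs => R (Fin.cons f fs)

theorem altFun_congr {k : ℕ} {b : Bool} {R R' : (Fin k → ℕ → W) → Prop}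
    (h : ∀ fs, R fs ↔ R' fs) : altFun k b R ↔ altFun k b R' := by
  have : R = R' := funext fun fs => propext (h fs)
  rw [this]

theorem not_altFun {k : ℕ} {b : Bool} {R : (Fin k → ℕ → W) → Prop} :
    ¬ altFun k b R ↔ altFun k (!b) fun fs => ¬ R fs := by
  induction k generalizing b with
  | zero => rfl
  | succ k ih => cases b <;> simp [altFun, ih]

/-- Every word denotes a function, and every function agrees on `S` with one denoted by a short
word. As `R` sees only values on `S`, the quantifiers can be exchanged one by one. -/
theorem altQuant_iff_altFun (dec : List Bool → ℕ → W) (N : ℕ) (S : Set ℕ)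
    (hdec : ∀ f : ℕ → W, ∃ y : List Bool, y.length ≤ N ∧ ∀ p ∈ S, dec y p = f p) {k : ℕ} :
    ∀ {b : Bool} {R : (Fin k → ℕ → W) → Prop},
      (∀ fs gs : Fin k → ℕ → W, (∀ i, ∀ p ∈ S, fs i p = gs i p) → (R fs ↔ R gs)) →
      (altQuant N k b (fun ys => R fun i => dec (ys i)) ↔ altFun k b R) := by
  induction k with
  | zero =>
    intro b R hR
    exact hR _ _ fun i => i.elim0
  | succ k ih =>
    intro b R hR
    have hcons : ∀ (y : List Bool) (ys : Fin k → List Bool),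
        (fun i => dec ((Fin.cons y ys : Fin (k + 1) → List Bool) i)) =
          (Fin.cons (dec y) fun i => dec (ys i) : Fin (k + 1) → ℕ → W) := by
      intro y ys
      funext i
      refine Fin.cases ?_ (fun i => ?_) i <;> simp
    have hR' : ∀ (f g : ℕ → W), (∀ p ∈ S, f p = g p) → ∀ fs gs : Fin k → ℕ → W,
        (∀ i, ∀ p ∈ S, fs i p = gs i p) →
        (R (Fin.cons f fs : Fin (k + 1) → ℕ → W) ↔ R (Fin.cons g gs : Fin (k + 1) → ℕ → W)) := by
      intro f g hfg fs gs h
      apply hR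
      intro i
      refine Fin.cases ?_ (fun i => ?_) i
      · simpa using hfg
      · simpa using h i
    have key : ∀ (b : Bool) (y : List Bool),
        altQuant N k b (fun ys => R fun i => dec ((Fin.cons y ys : Fin (k + 1) → List Bool) i)) ↔
          altFun k b fun fs => R (Fin.cons (dec y) fs) := by
      intro b y
      simp only [hcons]
      exact ih fun fs gs h => hR' _ _ (fun _ _ => rfl) fs gs h
    cases b with
    | true =>
      simp only [altQuant, altFun, key]
      constructor
      · rintro ⟨y, -, h⟩
        exact ⟨dec y, h⟩
      · rintro ⟨f, h⟩
        obtain ⟨y, hy, hf⟩ := hdec f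
        exact ⟨y, hy, (altFun_congr fun fs => hR' _ _ hf _ _ fun _ _ _ => rfl).2 h⟩
    | false =>
      simp only [altQuant, altFun, key]
      constructor
      · intro h f
        obtain ⟨y, hy, hf⟩ := hdec f
        exact (altFun_congr fun fs => hR' _ _ hf _ _ fun _ _ _ => rfl).1 (h y hy)
      · intro h y _
        exact h (dec y)

end Quantifiers

/-! ### Sizes of certificates, and automata in the polynomial hierarchy -/

/-- The variables of a formula. -/
def Formula.vars : Formula → List ℕ
  | var p => [p]
  | neg φ => φ.vars
  | conj φ χ => φ.vars ++ χ.vars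
  | disj φ χ => φ.vars ++ χ.vars
  | circ φ => φ.vars
  | tri φ => φ.vars

/-- Each occurrence of a variable is spelled out by its digits and the symbol `var`; hence
certificates for the variables of an instance are linear in its length. -/
theorem Formula.sum_vars_le (φ : Formula) :
    (φ.vars.map fun p => (encodeNat p).length + 1).sum ≤ φ.encode.length := by
  induction φ with
  | var p => simp [vars, encode]
  | neg φ ih | circ φ ih | tri φ ih => simp only [vars, encode, List.length_cons]; omega
  | conj φ χ ih₁ ih₂ | disj φ χ ih₁ ih₂ =>
    simp only [vars, encode, List.length_cons, List.map_append, List.sum_append,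
      List.length_append]
    omega

theorem sum_vars_encodeBlocks_le (bs : List (Marker × Formula)) :
    ((bs.flatMap fun b => b.2.vars).map fun p => (encodeNat p).length + 1).sum ≤
      (encodeBlocks bs).length := by
  induction bs with
  | nil => simp
  | cons b bs ih =>
    have := b.2.sum_vars_le
    simp only [List.flatMap_cons, List.map_append, List.sum_append, encodeBlocks_cons,
      List.length_cons, List.length_append]
    omega

namespace BlockAutomaton

variable {V A Q : Type} (M : BlockAutomaton V A Q)

theorem eval_congr {f g : ℕ → V} {φ : Formula} (h : ∀ p ∈ φ.vars, f p = g p) :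
    M.eval f φ = M.eval g φ := by
  induction φ with
  | var p => simp [eval, h p (by simp [Formula.vars])]
  | neg φ ih | circ φ ih | tri φ ih => simp only [eval]; rw [ih h]
  | conj φ χ ih₁ ih₂ | disj φ χ ih₁ ih₂ =>
    simp only [eval]
    rw [ih₁ fun p hp => h p (by simp [Formula.vars, hp]),
      ih₂ fun p hp => h p (by simp [Formula.vars, hp])]

theorem result_congr {f g : ℕ → V} {bs : List (Marker × Formula)}
    (h : ∀ p ∈ bs.flatMap fun b => b.2.vars, f p = g p) : M.result f bs = M.result g bs := by
  induction bs with
  | nil => rfl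
  | cons b bs ih =>
    simp only [List.flatMap_cons, List.mem_append] at h
    have h₁ := M.eval_congr (f := f) (g := g) (φ := b.2) fun p hp => h p (.inl hp)
    have h₂ := ih fun p hp => h p (.inr hp)
    simp only [result, List.foldr_cons] at h₂ ⊢
    rw [h₁, h₂]

/-- The state reached on a word, under a valuation of the variables; `none` if the word is not a
list of blocks. -/
def value (f : ℕ → V) (x : List Sym) : Option Q :=
  M.read (fun key => f (decodeNat key)) x

theorem value_encodeBlocks (f : ℕ → V) (bs : List (Marker × Formula)) :
    M.value f (encodeBlocks bs) = some (M.result f bs) := by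
  simp [value, read_encodeBlocks]

end BlockAutomaton

/-- A language given by alternating quantifiers over valuations and the final state of an automaton
is in the polynomial hierarchy. -/
theorem inSigmaP_of_automaton {m : ℕ} {W A Q : Type} [Finite W] [Finite A] [Finite Q]
    [Inhabited W] (M : BlockAutomaton (Fin (m + 1) → W) A Q) (acc : Option Q → Prop)
    {L : Set (List Sym)}
    (hL : ∀ x, x ∈ L ↔
      altFun (m + 1) true fun fs : Fin (m + 1) → ℕ → W => acc (M.value (fun p i => fs i p) x)) :
    InSigmaP (m + 1) L := by
  classical
  obtain ⟨n, tok, htok⟩ : ∃ (n : ℕ) (tok : Fin (n + 1) → Bool ⊕ W), Function.Surjective tok := by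
    obtain ⟨n, ⟨e⟩⟩ := Finite.exists_equiv_fin (Bool ⊕ W)
    cases n with
    | zero => exact (e (.inl true)).elim0
    | succ n => exact ⟨n, e.symm, e.symm.surjective⟩
  refine ⟨.C (n + 1) * .X, Evaluator.relation M tok fun q => decide (acc q),
    Evaluator.polyTimeDecidable_relation, fun x => ?_⟩
  rw [hL]
  -- On well-formed words every key looked up is a canonical numeral, so lookup by digits and lookup
  -- by index coincide.
  set dec : List Bool → ℕ → W := fun y p => lookup tok y (encodeNat p) with hdec
  have hrel : ∀ ys : Fin (m + 1) → List Bool,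
      Evaluator.relation M tok (fun q => decide (acc q)) (x, ys) ↔
        acc (M.value (fun p i => dec (ys i) p) x) := by
    intro ys
    simp only [Evaluator.relation, decide_eq_true_eq]
    by_cases hx : ∃ bs, x = encodeBlocks bs
    · obtain ⟨bs, rfl⟩ := hx
      rw [BlockAutomaton.read_encodeBlocks, BlockAutomaton.value_encodeBlocks]
    · rw [BlockAutomaton.value, BlockAutomaton.read_eq_none _ _ hx,
        BlockAutomaton.read_eq_none _ _ hx]
  simp only [hrel, Polynomial.eval_mul, Polynomial.eval_C, Polynomial.eval_X]
  by_cases hx : ∃ bs, x = encodeBlocks bs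
  · obtain ⟨bs, rfl⟩ := hx
    refine (altQuant_iff_altFun dec _ {p | p ∈ bs.flatMap fun b => b.2.vars} ?_
      (R := fun fs => acc (M.value (fun p i => fs i p) (encodeBlocks bs))) ?_).symm
    · intro f
      obtain ⟨y, hy, hf⟩ := exists_lookup_eq tok htok (fun key => f (decodeNat key))
        ((bs.flatMap fun b => b.2.vars).map encodeNat)
      refine ⟨y, hy.trans ?_, fun p hp => ?_⟩
      · have := sum_vars_encodeBlocks_le bs
        rw [List.map_map]
        exact Nat.mul_le_mul_left _ this
      · simpa [hdec] using hf (encodeNat p) (List.mem_map_of_mem hp)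
    · intro fs gs h
      rw [M.value_encodeBlocks, M.value_encodeBlocks, M.result_congr]
      intro p hp
      funext i
      exact h i p hp
  -- On a malformed word the functions are never relevant, so no agreement between them is required
  -- and the empty certificate represents each of them.
  · refine (altQuant_iff_altFun dec _ ∅ (fun f => ⟨[], by simp⟩)
      (R := fun fs => acc (M.value (fun p i => fs i p) x)) ?_).symm
    intro fs gs _
    rw [BlockAutomaton.value, BlockAutomaton.value, BlockAutomaton.read_eq_none _ _ hx,
      BlockAutomaton.read_eq_none _ _ hx]

end BDAbduction

namespace BDAbduction

open Computability PolyHierarchy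

/-! ## Theory-minimality in prenex form -/

section Prenex

variable {α X : Type}

/-- All elements of `τ` hold at `x`. -/
def Forces (D : α → X → Prop) (τ : Set α) (x : X) : Prop := ∀ a ∈ τ, D a x

/-- Theory-minimality of the set `τ` of literals, compared with sets of literals in `H`; `Γ`, `ψ`
and `D` say at which valuations the theory, the observation, and a literal hold, and `ok` holds
for the literals of the language. -/
def Minimal (Γ ψ : X → Prop) (D : α → X → Prop) (ok : α → Prop) (H τ : Set α) : Prop :=
  (τ.Nonempty ∧ (∀ a ∈ τ, ok a) ∧ (∃ x, Γ x ∧ ¬ ψ x) ∧ (∀ x, Γ x → Forces D τ x → ψ x) ∧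
    (∃ x, Γ x ∧ Forces D τ x) ∧ ∃ x, Forces D τ x ∧ ¬ ψ x) ∧
  ∀ φ ⊆ H, φ.Nonempty → (∀ a ∈ φ, ok a) →
    (∃ x, Γ x ∧ Forces D φ x ∧ ¬ ψ x) ∨ (∃ x, Γ x ∧ Forces D τ x ∧ ¬ Forces D φ x) ∨
    (∀ x, ¬ (Γ x ∧ Forces D φ x)) ∨ (∀ x, Forces D φ x → ψ x) ∨
    ∀ x, Γ x → Forces D φ x → Forces D τ x

/-- The quantifier-free matrix of `Minimal`. -/
def Matrix (Γ ψ : X → Prop) (D : α → X → Prop) (ok : α → Prop) (τ φ : Set α)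
    (u v : Fin 4 → X) : Prop :=
  (τ.Nonempty ∧ (∀ a ∈ τ, ok a) ∧ (Γ (v 0) ∧ ¬ ψ (v 0)) ∧
    (Γ (u 0) → Forces D τ (u 0) → ψ (u 0)) ∧
    (Γ (v 1) ∧ Forces D τ (v 1)) ∧ (Forces D τ (v 2) ∧ ¬ ψ (v 2))) ∧
  (φ.Nonempty → (∀ a ∈ φ, ok a) →
    (Γ (v 3) ∧ Forces D φ (v 3) ∧ ¬ ψ (v 3)) ∨ (Γ (v 3) ∧ Forces D τ (v 3) ∧ ¬ Forces D φ (v 3)) ∨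
    ¬ (Γ (u 1) ∧ Forces D φ (u 1)) ∨ (Forces D φ (u 2) → ψ (u 2)) ∨
    (Γ (u 3) → Forces D φ (u 3) → Forces D τ (u 3)))

/-- A disjunction of universal statements needs a variable for each (`u 1`, `u 2`, `u 3`), whereas
the two existential disjuncts share the witness `v 3`. Pulling the universal quantifiers out to the
left is harmless, as they do not occur in the existential statements. -/
theorem minimal_iff_matrix {Γ ψ : X → Prop} {D : α → X → Prop} {ok : α → Prop} {H τ : Set α}
    [Nonempty X] :
    Minimal Γ ψ D ok H τ ↔ ∀ φ ⊆ H, ∀ u : Fin 4 → X, ∃ v : Fin 4 → X,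
      Matrix Γ ψ D ok τ φ u v := by
  constructor
  · rintro ⟨⟨h1, h2, ⟨x0, h3⟩, h4, ⟨x1, h5⟩, x2, h6⟩, h7⟩ φ hφ u
    by_cases hn : φ.Nonempty ∧ ∀ a ∈ φ, ok a
    · rcases h7 φ hφ hn.1 hn.2 with ⟨x, h⟩ | ⟨x, h⟩ | h | h | h
      · exact ⟨![x0, x1, x2, x], ⟨h1, h2, h3, h4 _, h5, h6⟩, fun _ _ => .inl h⟩
      · exact ⟨![x0, x1, x2, x], ⟨h1, h2, h3, h4 _, h5, h6⟩, fun _ _ => .inr (.inl h)⟩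
      · exact ⟨![x0, x1, x2, x2], ⟨h1, h2, h3, h4 _, h5, h6⟩,
          fun _ _ => .inr (.inr (.inl (h _)))⟩
      · exact ⟨![x0, x1, x2, x2], ⟨h1, h2, h3, h4 _, h5, h6⟩,
          fun _ _ => .inr (.inr (.inr (.inl (h _))))⟩
      · exact ⟨![x0, x1, x2, x2], ⟨h1, h2, h3, h4 _, h5, h6⟩,
          fun _ _ => .inr (.inr (.inr (.inr (h _))))⟩
    · exact ⟨![x0, x1, x2, x2], ⟨h1, h2, h3, h4 _, h5, h6⟩, fun h h' => absurd ⟨h, h'⟩ hn⟩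
  · intro h
    -- The empty set is no term, so this instance is used only for the first half of the matrix,
    -- that τ is a proper solution.
    have h0 := h ∅ (Set.empty_subset _)
    obtain ⟨x⟩ := ‹Nonempty X›
    obtain ⟨v, ⟨h1, h2, h3, -, h5, h6⟩, -⟩ := h0 fun _ => x
    refine ⟨⟨h1, h2, ⟨_, h3⟩, fun y => ?_, ⟨_, h5⟩, ⟨_, h6⟩⟩, fun φ hφ hn hok => ?_⟩
    · obtain ⟨v, ⟨-, -, -, h4, -⟩, -⟩ := h0 fun _ => y
      exact h4
    · by_contra hcon
      simp only [not_or, not_exists, not_forall] at hcon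
      obtain ⟨g1, g2, ⟨x1, g3⟩, ⟨x2, g4, g5⟩, ⟨x3, g6, g7, g8⟩⟩ := hcon
      obtain ⟨v, -, hv⟩ := h φ hφ ![x, x1, x2, x3]
      rcases hv hn hok with h | h | h | h | h
      · exact g1 _ h
      · exact g2 _ h
      · exact g3 h
      · exact g5 (h g4)
      · exact g8 (h g6 g7)

/-- The matrix sees a literal only through where it holds and whether it belongs to the language.
Hence literals may be replaced by their values in a finite algebra, even where distinct literals get
equal values. -/
theorem matrix_image {β Y : Type} {Γ ψ : X → Prop} {D : α → X → Prop} {ok : α → Prop}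
    {Γ' ψ' : Y → Prop} {D' : β → Y → Prop} {ok' : β → Prop} (g : α → β) (e : Y → X)
    (hΓ : ∀ y, Γ' y ↔ Γ (e y)) (hψ : ∀ y, ψ' y ↔ ψ (e y)) (hD : ∀ a y, D' (g a) y ↔ D a (e y))
    (hok : ∀ a, ok' (g a) ↔ ok a) (τ φ : Set α) (u v : Fin 4 → Y) :
    Matrix Γ' ψ' D' ok' (g '' τ) (g '' φ) u v ↔
      Matrix Γ ψ D ok τ φ (fun i => e (u i)) (fun i => e (v i)) := by
  simp only [Matrix, Forces, Set.forall_mem_image, Set.image_nonempty, hΓ, hψ, hD, hok]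

end Prenex

/-! ## Theory-minimal solutions -/

theorem Four.designated_conj (a b : Four) :
    (a.conj b).Designated ↔ a.Designated ∧ b.Designated := by
  cases a <;> cases b <;> simp [Four.conj, Four.Designated]

theorem Lang.not_designated_bot (ℓ : Lang) (v : ℕ → Four) : ¬ (ℓ.bot.val v).Designated := by
  cases ℓ <;> cases h : v 0 <;>
    simp [Lang.bot, Formula.bullet, Formula.val, h, Four.circ, Four.neg, Four.tri, Four.conj,
      Four.Designated]

/-- The literal is at least true. -/
def Literal.Holds (l : Literal) (v : ℕ → Four) : Prop := (l.toFormula.val v).Designated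

theorem Term.designated_toFormula (τ : Term) (v : ℕ → Four) :
    (τ.toFormula.val v).Designated ↔ Forces Literal.Holds {l | l ∈ τ.lits} v := by
  have key : ∀ (ls : List Literal) (φ : Formula),
      ((ls.foldl (fun φ l => φ.conj l.toFormula) φ).val v).Designated ↔
        (φ.val v).Designated ∧ ∀ l ∈ ls, l.Holds v := by
    intro ls
    induction ls with
    | nil => simp
    | cons l ls ih =>
      intro φ
      simp [ih, Formula.val, Four.designated_conj, Literal.Holds, and_assoc]
  simp [Term.toFormula, Term.lits, Forces, key, Literal.Holds]

theorem Term.exists_lits (H : List Literal) (φ : Set Literal) (hφ : φ ⊆ {l | l ∈ H})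
    (hn : φ.Nonempty) : ∃ τ : Term, {l | l ∈ τ.lits} = φ := by
  classical
  have h : {l | l ∈ H.filter (· ∈ φ)} = φ := by
    ext l
    simp only [List.mem_filter, decide_eq_true_eq, Set.mem_ofPred_eq]
    exact ⟨fun h => h.2, fun h => ⟨hφ h, h⟩⟩
  rcases hl : H.filter (· ∈ φ) with _ | ⟨l, ls⟩
  · rw [hl] at h
    obtain ⟨a, ha⟩ := hn
    rw [← h] at ha
    simp at ha
  · exact ⟨⟨l, ls⟩, by rw [← h, hl]; rfl⟩

/-- All formulas of the theory are at least true. -/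
def Models (Γ : List Formula) (v : ℕ → Four) : Prop := ∀ φ ∈ Γ, (φ.val v).Designated

/-- Theory-minimality of the set `τ` of literals, for the given theory, observation, and
hypotheses. -/
def TheoryMinimal (ℓ : Lang) (Γ : List Formula) (ψ : Formula) (H : List Literal)
    (τ : Set Literal) : Prop :=
  Minimal (Models Γ) (fun v => (ψ.val v).Designated) Literal.Holds (Literal.InLang ℓ)
    {l | l ∈ H} τ

theorem Problem.entailsWith_iff (P : Problem) (τ : Term) (χ : Formula) : P.EntailsWith τ χ ↔
    ∀ v, Models P.theory v → Forces Literal.Holds {l | l ∈ τ.lits} v → (χ.val v).Designated := by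
  unfold EntailsWith Entails
  refine forall_congr' fun v => ?_
  rw [← Term.designated_toFormula]
  constructor
  · intro h h1 h2
    apply h
    rintro φ (hφ | rfl)
    · exact h1 φ hφ
    · exact h2
  · intro h h1
    exact h (fun φ hφ => h1 φ (.inl hφ)) (h1 _ (.inr rfl))

theorem Problem.isProperSolution_iff (ℓ : Lang) (P : Problem) (τ : Term) :
    P.IsProperSolution ℓ τ ↔ ((∀ l ∈ τ.lits, l ∈ P.hypotheses) ∧ (∀ l ∈ τ.lits, l.InLang ℓ) ∧
      (∀ v, Models P.theory v → Forces Literal.Holds {l | l ∈ τ.lits} v →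
        (P.observation.val v).Designated) ∧
      (∃ v, Models P.theory v ∧ Forces Literal.Holds {l | l ∈ τ.lits} v) ∧
      ∃ v, Forces Literal.Holds {l | l ∈ τ.lits} v ∧ ¬ (P.observation.val v).Designated) := by
  have h1 : (¬ Entails {τ.toFormula} P.observation) ↔
      ∃ v, Forces Literal.Holds {l | l ∈ τ.lits} v ∧ ¬ (P.observation.val v).Designated := by
    simp [Entails, Term.designated_toFormula]
  rw [IsProperSolution, IsSolution, entailsWith_iff, entailsWith_iff, h1]
  have h2 : ∀ v, ¬ (ℓ.bot.val v).Designated := ℓ.not_designated_bot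
  simp only [h2, imp_false, not_forall, not_not, exists_prop, forall_and, and_assoc]
  tauto

/-- `Minimal` restricts only the competitors to the hypotheses, so for τ this is a separate
conjunct. Its clause that Γ does not entail ψ comes from the problem itself. -/
theorem Problem.isTheoryMinimal_iff (ℓ : Lang) (P : Problem) (τ : Term) :
    P.IsTheoryMinimal ℓ τ ↔ (∀ l ∈ τ.lits, l ∈ P.hypotheses) ∧
      TheoryMinimal ℓ P.theory P.observation P.hypotheses {l | l ∈ τ.lits} := by
  have h0 : ∃ v, Models P.theory v ∧ ¬ (P.observation.val v).Designated := by
    simpa [Entails, Models] using P.not_entails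
  have h1 : {l | l ∈ τ.lits}.Nonempty := ⟨τ.first, by simp [Term.lits]⟩
  rw [IsTheoryMinimal, isProperSolution_iff, TheoryMinimal, Minimal]
  constructor
  · rintro ⟨⟨a, b, c, d, e⟩, h⟩
    refine ⟨a, ⟨h1, b, h0, c, d, e⟩, fun φ hφ hn hok => ?_⟩
    obtain ⟨σ, rfl⟩ := Term.exists_lits _ φ hφ hn
    by_contra hcon
    simp only [not_or, not_exists, not_forall, not_and, not_not] at hcon
    obtain ⟨g1, g2, ⟨x1, g3, g3'⟩, ⟨x2, g4, g5⟩, ⟨x3, g6, g7, g8⟩⟩ := hcon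
    refine h ⟨σ, (isProperSolution_iff _ _ _).2
      ⟨hφ, hok, g1, ⟨x1, g3, g3'⟩, ⟨x2, g4, g5⟩⟩, ?_, ?_⟩
    · rw [entailsWith_iff]
      intro h'
      exact g8 ((Term.designated_toFormula _ _).1 (h' _ g6 g7))
    · rw [entailsWith_iff]
      intro v hv hv'
      exact (Term.designated_toFormula _ _).2 (g2 v hv hv')
  · rintro ⟨a, ⟨-, b, -, c, d, e⟩, h⟩
    refine ⟨⟨a, b, c, d, e⟩, ?_⟩
    rintro ⟨σ, hσ, h2, h3⟩
    obtain ⟨a', b', c', ⟨x1, d'⟩, x2, e'⟩ := (isProperSolution_iff _ _ _).1 hσ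
    rw [entailsWith_iff] at h2 h3
    simp only [Term.designated_toFormula] at h2 h3
    rcases h {l | l ∈ σ.lits} a' ⟨σ.first, by simp [Term.lits]⟩ b' with
      ⟨x, g1, g2, g3⟩ | ⟨x, g1, g2, g3⟩ | g | g | g
    · exact g3 (c' x g1 g2)
    · exact g3 (h3 x g1 g2)
    · exact g x1 d'
    · exact e'.2 (g x2 e'.1)
    · exact h2 g

end BDAbduction

namespace BDAbduction

open Computability PolyHierarchy

/-! ## Instances as lists of blocks -/

/-- The blocks of an instance. -/
def instanceBlocks (Γ : List Formula) (ψ : Formula) (H qs : List Formula) :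
    List (Marker × Formula) :=
  Γ.map (fun φ => (.thy, φ)) ++ (.obs, ψ) :: (H.map (fun φ => (.hyp, φ)) ++
    qs.map fun φ => (.qry, φ))

/-- The word of an instance. -/
def instanceWord (Γ : List Formula) (ψ : Formula) (H qs : List Literal) : List Sym :=
  encodeBlocks (instanceBlocks Γ ψ (H.map Literal.toFormula) (qs.map Literal.toFormula))

theorem encodeInstance_eq (P : Problem) (ls : List Literal) :
    encodeInstance P ls = instanceWord P.theory P.observation P.hypotheses ls := by
  simp [encodeInstance, Problem.encode, instanceWord, encodeBlocks, instanceBlocks, Marker.sym,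
    List.flatMap_map]

/-- The automaton checking the order of the blocks, from right to left. -/
def nextStage : Marker → Fin 4 → Fin 4
  | .qry, 0 => 0
  | .hyp, 0 => 1
  | .hyp, 1 => 1
  | .obs, 0 => 2
  | .obs, 1 => 2
  | .thy, 2 => 2
  | _, _ => 3

/-- The automaton counting queries, up to two. -/
def nextCount : Marker → Fin 3 → Fin 3
  | .qry, 0 => 1
  | .qry, _ => 2
  | _, c => c

/-- The stage reached after all blocks. -/
def stage (bs : List (Marker × Formula)) : Fin 4 := bs.foldr (fun b s => nextStage b.1 s) 0

/-- The number of queries, up to two. -/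
def count (bs : List (Marker × Formula)) : Fin 3 := bs.foldr (fun b s => nextCount b.1 s) 0

theorem stage_instanceBlocks (Γ : List Formula) (ψ : Formula) (H qs : List Formula) :
    stage (instanceBlocks Γ ψ H qs) = 2 := by
  have h0 : stage (qs.map fun φ => (.qry, φ)) = 0 := by
    induction qs with
    | nil => rfl
    | cons φ qs ih => simp only [stage, List.map_cons, List.foldr_cons] at ih ⊢; rw [ih]; rfl
  have h1 : stage (H.map (fun φ => (.hyp, φ)) ++ qs.map fun φ => (.qry, φ)) = 0 ∨
      stage (H.map (fun φ => (.hyp, φ)) ++ qs.map fun φ => (.qry, φ)) = 1 := by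
    induction H with
    | nil => exact .inl h0
    | cons φ H ih =>
      simp only [stage, List.map_cons, List.cons_append, List.foldr_cons] at ih ⊢
      rcases ih with ih | ih <;> rw [ih] <;> exact .inr rfl
  induction Γ with
  | nil =>
    simp only [stage, instanceBlocks, List.map_nil, List.nil_append, List.foldr_cons] at h1 ⊢
    rcases h1 with h1 | h1 <;> rw [h1] <;> rfl
  | cons φ Γ ih =>
    simp only [stage, instanceBlocks, List.map_cons, List.cons_append, List.foldr_cons] at ih ⊢
    rw [ih]
    rfl

/-- The stages 0 and 1 describe the suffixes of an instance and carry the induction; stage 3 is a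
rejecting sink. -/
theorem exists_of_stage (bs : List (Marker × Formula)) :
    (stage bs = 0 → ∃ qs : List Formula, bs = qs.map fun φ => (.qry, φ)) ∧
    (stage bs = 1 → ∃ H qs : List Formula, bs = H.map (fun φ => (.hyp, φ)) ++
      qs.map fun φ => (.qry, φ)) ∧
    (stage bs = 2 → ∃ Γ ψ H qs, bs = instanceBlocks Γ ψ H qs) := by
  induction bs with
  | nil => simp [stage]
  | cons b bs ih =>
    obtain ⟨mk, φ⟩ := b
    have hs : stage ((mk, φ) :: bs) = nextStage mk (stage bs) := rfl
    rw [hs]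
    obtain ⟨ih0, ih1, ih2⟩ := ih
    generalize stage bs = s at ih0 ih1 ih2
    cases mk <;> fin_cases s <;> simp [nextStage] at ih0 ih1 ih2 ⊢
    · obtain ⟨Γ, ψ, H, qs, rfl⟩ := ih2
      exact ⟨φ :: Γ, ψ, H, qs, rfl⟩
    · obtain ⟨qs, rfl⟩ := ih0
      exact ⟨[], φ, [], qs, rfl⟩
    · obtain ⟨H, qs, rfl⟩ := ih1
      exact ⟨[], φ, H, qs, rfl⟩
    · obtain ⟨qs, rfl⟩ := ih0
      exact ⟨[φ], qs, rfl⟩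
    · obtain ⟨H, qs, rfl⟩ := ih1
      exact ⟨φ :: H, qs, rfl⟩
    · obtain ⟨qs, rfl⟩ := ih0
      exact ⟨φ :: qs, rfl⟩

theorem count_instanceBlocks (Γ : List Formula) (ψ : Formula) (H qs : List Formula) :
    count (instanceBlocks Γ ψ H qs) = 1 ↔ qs.length = 1 := by
  have h0 : ∀ qs : List Formula, count (qs.map fun φ => (.qry, φ)) =
      if qs.length = 0 then 0 else if qs.length = 1 then 1 else 2 := by
    intro qs
    induction qs with
    | nil => rfl
    | cons φ qs ih =>
      simp only [count, List.map_cons, List.foldr_cons] at ih ⊢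
      rw [ih]
      rcases qs with _ | ⟨a, _ | ⟨b, qs⟩⟩ <;> simp [nextCount]
  have h1 : count (H.map (fun φ => (.hyp, φ)) ++ qs.map fun φ => (.qry, φ)) =
      count (qs.map fun φ => (.qry, φ)) := by
    induction H with
    | nil => rfl
    | cons φ H ih => exact ih
  have h2 : count (instanceBlocks Γ ψ H qs) = count (qs.map fun φ => (.qry, φ)) := by
    rw [← h1]
    induction Γ with
    | nil => rfl
    | cons φ Γ ih => exact ih
  rw [h2, h0]
  split_ifs with h h' <;> simp_all

/-! ## The automaton -/

/-- The shapes of literals. -/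
inductive Kind
  | pos
  | neg
  | circ
  | bullet
  | tri
  | negTri
  | triNeg
  | negTriNeg

instance : Finite Kind :=
  Finite.of_surjective
    (fun i : Fin 8 => [Kind.pos, .neg, .circ, .bullet, .tri, .negTri, .triNeg, .negTriNeg].get i)
    fun κ => by
      cases κ
      exacts [⟨0, rfl⟩, ⟨1, rfl⟩, ⟨2, rfl⟩, ⟨3, rfl⟩, ⟨4, rfl⟩, ⟨5, rfl⟩, ⟨6, rfl⟩, ⟨7, rfl⟩]

instance : Finite Four :=
  Finite.of_surjective (fun i : Fin 4 => [Four.T, .B, .N, .F].get i) fun a => by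
    cases a
    exacts [⟨0, rfl⟩, ⟨1, rfl⟩, ⟨2, rfl⟩, ⟨3, rfl⟩]

instance : Inhabited Four := ⟨.F⟩

instance : Finite Marker := inferInstance

/-- The literal of the given shape and variable. -/
def Kind.literal : Kind → ℕ → Literal
  | pos, p => .pos p
  | neg, p => .neg p
  | circ, p => .circ p
  | bullet, p => .bullet p
  | tri, p => .tri p
  | negTri, p => .negTri p
  | triNeg, p => .triNeg p
  | negTriNeg, p => .negTriNeg p

/-- The shape of a literal. -/
def Literal.kind : Literal → Kind
  | pos _ => .pos
  | neg _ => .neg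
  | circ _ => .circ
  | bullet _ => .bullet
  | tri _ => .tri
  | negTri _ => .negTri
  | triNeg _ => .triNeg
  | negTriNeg _ => .negTriNeg

/-- The variable of a literal. -/
def Literal.index : Literal → ℕ
  | pos p => p
  | neg p => p
  | circ p => p
  | bullet p => p
  | tri p => p
  | negTri p => p
  | triNeg p => p
  | negTriNeg p => p

theorem Literal.literal_kind (l : Literal) : l.kind.literal l.index = l := by cases l <;> rfl

theorem Kind.inLang_literal (κ : Kind) (ℓ : Lang) (p : ℕ) :
    (κ.literal p).InLang ℓ ↔ (κ.literal 0).InLang ℓ := by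
  cases κ <;> cases ℓ <;> simp [literal, Literal.InLang]

/-- The shape obtained by negation. -/
def Kind.negate : Kind → Option Kind
  | pos => some neg
  | circ => some bullet
  | tri => some negTri
  | triNeg => some negTriNeg
  | _ => none

/-- The shape obtained by `∘`. -/
def Kind.applyCirc : Kind → Option Kind
  | pos => some circ
  | _ => none

/-- The shape obtained by `△`. -/
def Kind.applyTri : Kind → Option Kind
  | pos => some tri
  | neg => some triNeg
  | _ => none

/-- What a quantifier over functions chooses at a variable: the literals that belong to a term, and
the values under five valuations. -/
abbrev Cell := (Kind → Bool) × (Fin 5 → Four)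

/-- What the automaton knows about a formula: its values under all valuations, its shape and
the choices made at its variable, if it is a literal, and whether it belongs to `L_BD`. -/
abbrev Info (m : ℕ) :=
  (Fin (m + 1) → Fin 5 → Four) × Option (Kind × (Fin (m + 1) → Cell)) × Bool

/-- The automaton for all three problems. It collects the values of all blocks. -/
def collector (m : ℕ) : BlockAutomaton (Fin (m + 1) → Cell) (Info m)
    (Fin 4 × Fin 3 × Set (Marker × Info m)) where
  var w := (fun j i => (w j).2 i, some (.pos, w), true)
  neg a := (fun j i => (a.1 j i).neg, a.2.1.bind fun x => x.1.negate.map fun κ => (κ, x.2), a.2.2)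
  conj a b := (fun j i => (a.1 j i).conj (b.1 j i), none, a.2.2 && b.2.2)
  disj a b := (fun j i => (a.1 j i).disj (b.1 j i), none, a.2.2 && b.2.2)
  circ a :=
    (fun j i => (a.1 j i).circ, a.2.1.bind fun x => x.1.applyCirc.map fun κ => (κ, x.2), false)
  tri a := (fun j i => (a.1 j i).tri, a.2.1.bind fun x => x.1.applyTri.map fun κ => (κ, x.2), false)
  init := (0, 0, ∅)
  -- A subset of a finite type keeps the state finite however long the instance is. The order of the
  -- blocks and the number of queries, which the set forgets, are tracked by the other two
  -- components.
  step mk a q := (nextStage mk q.1, nextCount mk q.2.1, insert (mk, a) q.2.2)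

variable {m : ℕ}

theorem collector_val (F : ℕ → Fin (m + 1) → Cell) (φ : Formula) (j : Fin (m + 1)) (i : Fin 5) :
    ((collector m).eval F φ).1 j i = φ.val fun p => (F p j).2 i := by
  induction φ with
  | var p => rfl
  | neg φ ih | circ φ ih | tri φ ih => simp only [Formula.val, ← ih]; rfl
  | conj φ χ ih₁ ih₂ | disj φ χ ih₁ ih₂ => simp only [Formula.val, ← ih₁, ← ih₂]; rfl

theorem collector_isBD (F : ℕ → Fin (m + 1) → Cell) (φ : Formula) :
    ((collector m).eval F φ).2.2 = true ↔ φ.IsBD := by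
  induction φ with
  | var p => simp [BlockAutomaton.eval, collector, Formula.IsBD]
  | neg φ ih => exact ih
  | circ φ ih | tri φ ih => simp [BlockAutomaton.eval, collector, Formula.IsBD]
  | conj φ χ ih₁ ih₂ | disj φ χ ih₁ ih₂ =>
    rw [Formula.IsBD, ← ih₁, ← ih₂]
    simp [BlockAutomaton.eval, collector]

/-- A finite algebra cannot record the variable of a literal, only the choices `F p` made at it. -/
theorem collector_literal (F : ℕ → Fin (m + 1) → Cell) (φ : Formula) (κ : Kind)
    (w : Fin (m + 1) → Cell) : ((collector m).eval F φ).2.1 = some (κ, w) ↔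
      ∃ p, φ = (κ.literal p).toFormula ∧ w = F p := by
  induction φ generalizing κ w with
  | var p =>
    cases κ <;> simp [BlockAutomaton.eval, collector, Kind.literal, Literal.toFormula,
      Formula.bullet, eq_comm]
  | conj φ χ ih₁ ih₂ | disj φ χ ih₁ ih₂ =>
    cases κ <;> simp [BlockAutomaton.eval, collector, Kind.literal, Literal.toFormula,
      Formula.bullet]
  | neg φ ih =>
    have : ((collector m).eval F φ.neg).2.1 = some (κ, w) ↔
        ∃ κ', ((collector m).eval F φ).2.1 = some (κ', w) ∧ κ'.negate = some κ := by
      simp [BlockAutomaton.eval, collector, Option.bind_eq_some_iff]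
    simp only [this, ih]
    constructor
    · rintro ⟨κ', ⟨p, rfl, rfl⟩, h⟩
      refine ⟨p, ?_, rfl⟩
      cases κ' <;> simp only [Kind.negate, reduceCtorEq, Option.some.injEq] at h <;> subst h <;> rfl
    · rintro ⟨p, h, rfl⟩
      cases κ <;> simp only [Kind.literal, Literal.toFormula, Formula.bullet, reduceCtorEq,
        Formula.neg.injEq] at h <;> subst h
      · exact ⟨.pos, ⟨p, rfl, rfl⟩, rfl⟩
      · exact ⟨.circ, ⟨p, rfl, rfl⟩, rfl⟩
      · exact ⟨.tri, ⟨p, rfl, rfl⟩, rfl⟩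
      · exact ⟨.triNeg, ⟨p, rfl, rfl⟩, rfl⟩
  | circ φ ih =>
    have : ((collector m).eval F φ.circ).2.1 = some (κ, w) ↔
        ∃ κ', ((collector m).eval F φ).2.1 = some (κ', w) ∧ κ'.applyCirc = some κ := by
      simp [BlockAutomaton.eval, collector, Option.bind_eq_some_iff]
    simp only [this, ih]
    constructor
    · rintro ⟨κ', ⟨p, rfl, rfl⟩, h⟩
      refine ⟨p, ?_, rfl⟩
      cases κ' <;> simp only [Kind.applyCirc, reduceCtorEq, Option.some.injEq] at h
      all_goals
        subst h
        rfl
    · rintro ⟨p, h, rfl⟩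
      cases κ <;> simp only [Kind.literal, Literal.toFormula, Formula.bullet, reduceCtorEq,
        Formula.circ.injEq] at h
      subst h
      exact ⟨.pos, ⟨p, rfl, rfl⟩, rfl⟩
  | tri φ ih =>
    have : ((collector m).eval F φ.tri).2.1 = some (κ, w) ↔
        ∃ κ', ((collector m).eval F φ).2.1 = some (κ', w) ∧ κ'.applyTri = some κ := by
      simp [BlockAutomaton.eval, collector, Option.bind_eq_some_iff]
    simp only [this, ih]
    constructor
    · rintro ⟨κ', ⟨p, rfl, rfl⟩, h⟩
      refine ⟨p, ?_, rfl⟩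
      cases κ' <;> simp only [Kind.applyTri, reduceCtorEq, Option.some.injEq] at h
      all_goals
        subst h
        rfl
    · rintro ⟨p, h, rfl⟩
      cases κ <;> simp only [Kind.literal, Literal.toFormula, Formula.bullet, reduceCtorEq,
        Formula.tri.injEq] at h <;> subst h
      · exact ⟨.pos, ⟨p, rfl, rfl⟩, rfl⟩
      · exact ⟨.neg, ⟨p, rfl, rfl⟩, rfl⟩

/-- The values of all blocks. -/
def blockValues (F : ℕ → Fin (m + 1) → Cell) (bs : List (Marker × Formula)) :
    Set (Marker × Info m) :=
  {x | ∃ φ, (x.1, φ) ∈ bs ∧ x.2 = (collector m).eval F φ}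

theorem collector_result (F : ℕ → Fin (m + 1) → Cell) (bs : List (Marker × Formula)) :
    (collector m).result F bs = (stage bs, count bs, blockValues F bs) := by
  induction bs with
  | nil => simp [BlockAutomaton.result, collector, stage, count, blockValues]
  | cons b bs ih =>
    have : (collector m).result F (b :: bs) =
        (collector m).step b.1 ((collector m).eval F b.2) ((collector m).result F bs) := rfl
    rw [this, ih]
    refine Prod.ext rfl (Prod.ext rfl ?_)
    ext ⟨mk, a⟩
    obtain ⟨mk', φ⟩ := b
    simp only [collector, blockValues, Set.mem_insert_iff, Prod.mk.injEq, Set.mem_ofPred_eq,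
      List.mem_cons]
    constructor
    · rintro (⟨rfl, rfl⟩ | ⟨χ, h, rfl⟩)
      · exact ⟨φ, .inl ⟨rfl, rfl⟩, rfl⟩
      · exact ⟨χ, .inr h, rfl⟩
    · rintro ⟨χ, ⟨rfl, rfl⟩ | h, rfl⟩
      · exact .inl ⟨rfl, rfl⟩
      · exact .inr ⟨χ, h, rfl⟩

/-- Acceptance of the well-formed words that satisfy a given condition. -/
def Accepts (Φ : Fin 3 → Set (Marker × Info m) → Prop) :
    Option (Fin 4 × Fin 3 × Set (Marker × Info m)) → Prop
  | none => False
  | some (s, c, S) => (s = 2 ∧ ∀ x ∈ S, (x.1 = .thy ∨ x.1 = .obs → x.2.2.2 = true) ∧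
      (x.1 = .hyp ∨ x.1 = .qry → ∃ κ w, x.2.2.1 = some (κ, w))) ∧ Φ c S

theorem mem_blockValues {F : ℕ → Fin (m + 1) → Cell} {Γ : List Formula} {ψ : Formula}
    {H qs : List Literal} {x : Marker × Info m} :
    x ∈ blockValues F (instanceBlocks Γ ψ (H.map Literal.toFormula) (qs.map Literal.toFormula)) ↔
      (x.1 = .thy ∧ ∃ φ ∈ Γ, x.2 = (collector m).eval F φ) ∨
      (x.1 = .obs ∧ x.2 = (collector m).eval F ψ) ∨
      (x.1 = .hyp ∧ ∃ l ∈ H, x.2 = (collector m).eval F l.toFormula) ∨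
      (x.1 = .qry ∧ ∃ l ∈ qs, x.2 = (collector m).eval F l.toFormula) := by
  obtain ⟨mk, a⟩ := x
  cases mk <;> simp [blockValues, instanceBlocks]

theorem accepts_instanceWord {Φ : Fin 3 → Set (Marker × Info m) → Prop}
    {F : ℕ → Fin (m + 1) → Cell} {Γ : List Formula} {ψ : Formula} {H qs : List Literal}
    (hΓ : ∀ φ ∈ Γ, φ.IsBD) (hψ : ψ.IsBD) :
    Accepts Φ ((collector m).value F (instanceWord Γ ψ H qs)) ↔
      Φ (count (instanceBlocks Γ ψ (H.map Literal.toFormula) (qs.map Literal.toFormula)))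
        (blockValues F
          (instanceBlocks Γ ψ (H.map Literal.toFormula) (qs.map Literal.toFormula))) := by
  rw [instanceWord, BlockAutomaton.value_encodeBlocks, collector_result, Accepts,
    and_iff_right_iff_imp]
  refine fun _ => ⟨stage_instanceBlocks _ _ _ _, ?_⟩
  have hl : ∀ l : Literal, ∃ κ w, ((collector m).eval F l.toFormula).2.1 = some (κ, w) := fun l =>
    ⟨l.kind, F l.index, (collector_literal F _ _ _).2 ⟨l.index, by rw [l.literal_kind], rfl⟩⟩
  rintro ⟨mk, a⟩ hx
  rcases mem_blockValues.1 hx with ⟨rfl, φ, hφ, rfl⟩ | ⟨rfl, rfl⟩ | ⟨rfl, l, hl', rfl⟩ |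
    ⟨rfl, l, hl', rfl⟩
  · simp [collector_isBD, hΓ φ hφ]
  · simp [collector_isBD, hψ]
  · simpa using hl l
  · simpa using hl l

theorem exists_instanceWord_of_accepts {Φ : Fin 3 → Set (Marker × Info m) → Prop}
    {F : ℕ → Fin (m + 1) → Cell} {x : List Sym} (h : Accepts Φ ((collector m).value F x)) :
    ∃ Γ ψ H qs, ((∀ φ ∈ Γ, φ.IsBD) ∧ ψ.IsBD) ∧ x = instanceWord Γ ψ H qs := by
  by_cases hx : ∃ bs, x = encodeBlocks bs
  · obtain ⟨bs, rfl⟩ := hx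
    rw [BlockAutomaton.value_encodeBlocks, collector_result, Accepts] at h
    obtain ⟨⟨h1, h2⟩, -⟩ := h
    obtain ⟨Γ, ψ, H, qs, rfl⟩ := (exists_of_stage bs).2.2 h1
    have hmem : ∀ mk φ, (mk, φ) ∈ instanceBlocks Γ ψ H qs → _ := fun mk φ hφ =>
      h2 (mk, (collector m).eval F φ) ⟨φ, hφ, rfl⟩
    have hlits : ∀ φs : List Formula, (∀ φ ∈ φs, ∃ κ w,
        ((collector m).eval F φ).2.1 = some (κ, w)) →
        ∃ ls : List Literal, φs = ls.map Literal.toFormula := by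
      intro φs
      induction φs with
      | nil => exact fun _ => ⟨[], rfl⟩
      | cons φ φs ih =>
        intro hφs
        obtain ⟨ls, rfl⟩ := ih fun χ hχ => hφs χ (List.mem_cons_of_mem _ hχ)
        obtain ⟨κ, w, hw⟩ := hφs φ List.mem_cons_self
        obtain ⟨p, rfl, -⟩ := (collector_literal F _ _ _).1 hw
        exact ⟨κ.literal p :: ls, rfl⟩
    obtain ⟨H, rfl⟩ := hlits H fun φ hφ =>
      (hmem .hyp φ (by simp [instanceBlocks, hφ])).2 (.inl rfl)
    obtain ⟨qs, rfl⟩ := hlits qs fun φ hφ =>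
      (hmem .qry φ (by simp [instanceBlocks, hφ])).2 (.inr rfl)
    refine ⟨Γ, ψ, H, qs, ⟨fun φ hφ => ?_, ?_⟩, rfl⟩
    · exact (collector_isBD F φ).1 ((hmem .thy φ (by simp [instanceBlocks, hφ])).1 (.inl rfl))
    · exact (collector_isBD F ψ).1 ((hmem .obs ψ (by simp [instanceBlocks])).1 (.inr rfl))
  · rw [BlockAutomaton.value, BlockAutomaton.read_eq_none _ _ hx] at h
    exact h.elim

theorem not_altFun_false {W : Type} [Nonempty W] (k : ℕ) (b : Bool) :
    ¬ altFun (W := W) k b fun _ => False := by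
  induction k generalizing b with
  | zero => exact id
  | succ k ih => cases b <;> simp [altFun, ih]

/-- The valuations in an instance, and the condition on it, as alternating quantifiers. -/
theorem exists_instanceWord_iff {b : Bool} (Φ : Fin 3 → Set (Marker × Info m) → Prop)
    (Sem : List Formula → Formula → List Literal → List Literal → Prop)
    (h : ∀ Γ ψ H qs, Sem Γ ψ H qs ↔ altFun (m + 1) b fun fs : Fin (m + 1) → ℕ → Cell =>
      Φ (count (instanceBlocks Γ ψ (H.map Literal.toFormula) (qs.map Literal.toFormula)))
        (blockValues (fun p i => fs i p)
          (instanceBlocks Γ ψ (H.map Literal.toFormula) (qs.map Literal.toFormula))))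
    (x : List Sym) :
    (∃ Γ ψ H qs, ((∀ φ ∈ Γ, φ.IsBD) ∧ ψ.IsBD) ∧ x = instanceWord Γ ψ H qs ∧ Sem Γ ψ H qs) ↔
      altFun (m + 1) b fun fs : Fin (m + 1) → ℕ → Cell =>
        Accepts Φ ((collector m).value (fun p i => fs i p) x) := by
  have key : ∀ Γ ψ H qs, ((∀ φ ∈ Γ, φ.IsBD) ∧ ψ.IsBD) → x = instanceWord Γ ψ H qs →
      (Sem Γ ψ H qs ↔ altFun (m + 1) b fun fs : Fin (m + 1) → ℕ → Cell =>
        Accepts Φ ((collector m).value (fun p i => fs i p) x)) := by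
    rintro Γ ψ H qs ⟨hΓ, hψ⟩ rfl
    rw [h]
    exact altFun_congr fun fs => (accepts_instanceWord hΓ hψ).symm
  constructor
  · rintro ⟨Γ, ψ, H, qs, hBD, hx, hS⟩
    exact (key Γ ψ H qs hBD hx).1 hS
  · intro hacc
    by_cases hx : ∃ Γ ψ H qs, ((∀ φ ∈ Γ, φ.IsBD) ∧ ψ.IsBD) ∧ x = instanceWord Γ ψ H qs
    · obtain ⟨Γ, ψ, H, qs, hBD, hx⟩ := hx
      exact ⟨Γ, ψ, H, qs, hBD, hx, (key Γ ψ H qs hBD hx).2 hacc⟩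
    -- A word that encodes no instance is rejected under all choices, and quantifiers over a
    -- nonempty type do not make a false matrix true.
    · refine absurd ((altFun_congr fun fs => ?_).1 hacc) (not_altFun_false (W := Cell) (m + 1) b)
      exact ⟨fun h' => hx (exists_instanceWord_of_accepts h'), False.elim⟩

end BDAbduction

namespace BDAbduction

open Computability PolyHierarchy

/-! ## The acceptance conditions -/

section Conditions

variable {m : ℕ}

/-- The theory holds at a valuation, named by a quantifier block and a number. -/
def theoryHolds (S : Set (Marker × Info m)) (y : Fin (m + 1) × Fin 5) : Prop :=
  ∀ a, (Marker.thy, a) ∈ S → (a.1 y.1 y.2).Designated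

/-- The observation holds at a valuation. -/
def observationHolds (S : Set (Marker × Info m)) (y : Fin (m + 1) × Fin 5) : Prop :=
  ∀ a, (Marker.obs, a) ∈ S → (a.1 y.1 y.2).Designated

/-- A formula holds at a valuation. -/
def infoHolds (a : Info m) (y : Fin (m + 1) × Fin 5) : Prop := (a.1 y.1 y.2).Designated

/-- The formula is a literal of the language. -/
def infoInLang (ℓ : Lang) (a : Info m) : Prop :=
  ∃ κ w, a.2.1 = some (κ, w) ∧ (κ.literal 0).InLang ℓ

/-- The formula is a literal that the quantifier block puts into its term. -/
def infoChosen (j : Fin (m + 1)) (a : Info m) : Prop :=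
  ∃ κ w, a.2.1 = some (κ, w) ∧ (w j).1 κ = true

/-- The term chosen by a quantifier block. -/
def chosenTerm (j : Fin (m + 1)) (S : Set (Marker × Info m)) : Set (Info m) :=
  {a | (Marker.hyp, a) ∈ S ∧ infoChosen j a}

/-- The queried literals. -/
def queryTerm (S : Set (Marker × Info m)) : Set (Info m) := {a | (Marker.qry, a) ∈ S}

/-- The matrix of theory-minimality of `τ`, the universal choices being those of the block `j` and
the existential ones those of the block `k`. -/
def infoMatrix (ℓ : Lang) (S : Set (Marker × Info m)) (τ : Set (Info m)) (j k : Fin (m + 1)) :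
    Prop :=
  Matrix (theoryHolds S) (observationHolds S) infoHolds (infoInLang ℓ) τ (chosenTerm j S)
    (fun i => (j, i.castSucc)) (fun i => (k, i.castSucc))

/-- All queried literals are hypotheses, as far as the term chosen by the block `j` can tell. -/
def queryAmong (j : Fin (m + 1)) (S : Set (Marker × Info m)) : Prop :=
  (∀ a, (Marker.hyp, a) ∈ S → infoChosen j a) → ∀ a ∈ queryTerm S, infoChosen j a

/-- The valuations chosen at the variables. -/
def point (c : ℕ → Cell) (i : Fin 5) : ℕ → Four := fun p => (c p).2 i

/-- The literal is chosen. -/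
def Literal.Chosen (c : ℕ → Cell) (l : Literal) : Prop := (c l.index).1 l.kind = true

/-- The hypotheses that are chosen. -/
def chosenFrom (H : List Literal) (c : ℕ → Cell) : Set Literal := {l | l ∈ H ∧ l.Chosen c}

/-- The matrix of theory-minimality of `τ`. -/
def cellMatrix (ℓ : Lang) (Γ : List Formula) (ψ : Formula) (H : List Literal) (τ : Set Literal)
    (c d : ℕ → Cell) : Prop :=
  Matrix (Models Γ) (fun v => (ψ.val v).Designated) Literal.Holds (Literal.InLang ℓ) τ
    (chosenFrom H c) (fun i => point c i.castSucc) (fun i => point d i.castSucc)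

open Classical in
/-- The choice of a set of literals and of valuations. -/
noncomputable def cells (φ : Set Literal) (u : Fin 5 → ℕ → Four) : ℕ → Cell :=
  fun p => (fun κ => decide (κ.literal p ∈ φ), fun i => u i p)

@[simp] theorem chosen_cells (φ : Set Literal) (u : Fin 5 → ℕ → Four) (l : Literal) :
    l.Chosen (cells φ u) ↔ l ∈ φ := by
  simp [Literal.Chosen, cells, l.literal_kind]

@[simp] theorem point_cells (φ : Set Literal) (u : Fin 5 → ℕ → Four) (i : Fin 5) :
    point (cells φ u) i = u i := rfl

theorem chosenFrom_cells {H : List Literal} {φ : Set Literal} (hφ : φ ⊆ {l | l ∈ H})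
    (u : Fin 5 → ℕ → Four) : chosenFrom H (cells φ u) = φ := by
  ext l
  simp only [chosenFrom, chosen_cells, Set.mem_ofPred_eq, and_iff_right_iff_imp]
  exact fun h => hφ h

/-- One function `c` carries both the competitor and the four universal valuations. The literals of
`d` and the fifth valuations play no part here and are filled with `∅` and `default`. -/
theorem theoryMinimal_iff (ℓ : Lang) (Γ : List Formula) (ψ : Formula) (H : List Literal)
    (τ : Set Literal) : TheoryMinimal ℓ Γ ψ H τ ↔
      ∀ c : ℕ → Cell, ∃ d : ℕ → Cell, cellMatrix ℓ Γ ψ H τ c d := by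
  rw [TheoryMinimal, minimal_iff_matrix]
  constructor
  · intro h c
    obtain ⟨v, hv⟩ := h (chosenFrom H c) (fun l hl => hl.1) fun i => point c i.castSucc
    exact ⟨cells ∅ (Fin.snoc v default), by simpa [cellMatrix] using hv⟩
  · intro h φ hφ u
    obtain ⟨d, hd⟩ := h (cells φ (Fin.snoc u default))
    refine ⟨fun i => point d i.castSucc, ?_⟩
    simpa [cellMatrix, chosenFrom_cells hφ] using hd

/-! ### From values of blocks back to formulas and literals -/

section Transfer

variable (fs : Fin (m + 1) → ℕ → Cell) (Γ : List Formula) (ψ : Formula) (H qs : List Literal)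

/-- The values of the blocks of an instance. -/
def instanceValues : Set (Marker × Info m) :=
  blockValues (fun p i => fs i p)
    (instanceBlocks Γ ψ (H.map Literal.toFormula) (qs.map Literal.toFormula))

/-- The value of a literal. -/
def literalInfo (l : Literal) : Info m := (collector m).eval (fun p i => fs i p) l.toFormula

theorem theoryHolds_iff (y : Fin (m + 1) × Fin 5) :
    theoryHolds (instanceValues fs Γ ψ H qs) y ↔ Models Γ (point (fs y.1) y.2) := by
  constructor
  · intro h φ hφ
    have := h _ (mem_blockValues.2 (.inl ⟨rfl, φ, hφ, rfl⟩))
    rwa [collector_val] at this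
  · intro h a ha
    obtain ⟨φ, hφ, rfl⟩ : ∃ φ ∈ Γ, a = (collector m).eval (fun p i => fs i p) φ := by
      simpa [instanceValues, mem_blockValues] using ha
    rw [collector_val]
    exact h φ hφ

theorem observationHolds_iff (y : Fin (m + 1) × Fin 5) :
    observationHolds (instanceValues fs Γ ψ H qs) y ↔
      (ψ.val (point (fs y.1) y.2)).Designated := by
  simp only [observationHolds, instanceValues, mem_blockValues, reduceCtorEq, false_and, true_and,
    false_or, or_false, forall_eq, collector_val]
  rfl

theorem infoHolds_iff (l : Literal) (y : Fin (m + 1) × Fin 5) :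
    infoHolds (literalInfo fs l) y ↔ l.Holds (point (fs y.1) y.2) := by
  rw [infoHolds, literalInfo, collector_val]
  rfl

theorem literalInfo_eq (l : Literal) (κ : Kind) (w : Fin (m + 1) → Cell) :
    (literalInfo fs l).2.1 = some (κ, w) ↔ κ = l.kind ∧ w = fun i => fs i l.index := by
  rw [literalInfo, collector_literal]
  constructor
  · rintro ⟨p, h, rfl⟩
    obtain rfl := Literal.toFormula_injective h
    cases κ <;> exact ⟨rfl, rfl⟩
  · rintro ⟨rfl, rfl⟩
    exact ⟨l.index, by rw [l.literal_kind], rfl⟩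

theorem infoInLang_iff (ℓ : Lang) (l : Literal) :
    infoInLang ℓ (literalInfo fs l) ↔ l.InLang ℓ := by
  simp only [infoInLang, literalInfo_eq]
  constructor
  · rintro ⟨κ, w, ⟨rfl, rfl⟩, h⟩
    rw [← l.literal_kind]
    exact (Kind.inLang_literal _ _ _).2 h
  · intro h
    rw [← l.literal_kind] at h
    exact ⟨_, _, ⟨rfl, rfl⟩, (Kind.inLang_literal _ _ _).1 h⟩

theorem infoChosen_iff (j : Fin (m + 1)) (l : Literal) :
    infoChosen j (literalInfo fs l) ↔ l.Chosen (fs j) := by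
  simp only [infoChosen, literalInfo_eq, Literal.Chosen]
  exact ⟨fun ⟨κ, w, ⟨hκ, hw⟩, h⟩ => by subst hκ hw; exact h, fun h => ⟨_, _, ⟨rfl, rfl⟩, h⟩⟩

theorem mem_instanceValues_hyp (a : Info m) : (Marker.hyp, a) ∈ instanceValues fs Γ ψ H qs ↔
    ∃ l ∈ H, a = literalInfo fs l := by
  simp [instanceValues, mem_blockValues, literalInfo]

theorem mem_instanceValues_qry (a : Info m) : (Marker.qry, a) ∈ instanceValues fs Γ ψ H qs ↔
    ∃ l ∈ qs, a = literalInfo fs l := by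
  simp [instanceValues, mem_blockValues, literalInfo]

theorem chosenTerm_eq (j : Fin (m + 1)) : chosenTerm j (instanceValues fs Γ ψ H qs) =
    literalInfo fs '' chosenFrom H (fs j) := by
  ext a
  simp only [chosenTerm, mem_instanceValues_hyp, Set.mem_ofPred_eq, Set.mem_image, chosenFrom]
  constructor
  · rintro ⟨⟨l, hl, rfl⟩, h⟩
    exact ⟨l, ⟨hl, (infoChosen_iff fs j l).1 h⟩, rfl⟩
  · rintro ⟨l, ⟨hl, h⟩, rfl⟩
    exact ⟨⟨l, hl, rfl⟩, (infoChosen_iff fs j l).2 h⟩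

theorem queryTerm_eq : queryTerm (instanceValues fs Γ ψ H qs) =
    literalInfo fs '' {l | l ∈ qs} := by
  ext a
  simp [queryTerm, mem_instanceValues_qry, eq_comm]

theorem infoMatrix_iff (ℓ : Lang) (τ : Set Literal) (j k : Fin (m + 1)) :
    infoMatrix ℓ (instanceValues fs Γ ψ H qs) (literalInfo fs '' τ) j k ↔
      cellMatrix ℓ Γ ψ H τ (fs j) (fs k) := by
  rw [infoMatrix, chosenTerm_eq, matrix_image (Γ := Models Γ)
    (ψ := fun v => (ψ.val v).Designated) (D := Literal.Holds) (ok := Literal.InLang ℓ)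
    (literalInfo fs) (fun y => point (fs y.1) y.2)
    (theoryHolds_iff fs Γ ψ H qs) (observationHolds_iff fs Γ ψ H qs) (infoHolds_iff fs)
    (infoInLang_iff fs ℓ)]
  rfl

theorem queryChosen_iff (j : Fin (m + 1)) :
    (∀ a ∈ queryTerm (instanceValues fs Γ ψ H qs), infoChosen j a) ↔
      ∀ l ∈ qs, l.Chosen (fs j) := by
  rw [queryTerm_eq, Set.forall_mem_image]
  simp only [infoChosen_iff, Set.mem_ofPred_eq]

/-- Distinct literals may have equal values, so whether the queries are hypotheses cannot be read
off one set of values. Under a universal choice it can: every choice containing `H` contains the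
queries, and the choice of exactly `H` is decisive. -/
theorem queryAmong_iff (j : Fin (m + 1)) : queryAmong j (instanceValues fs Γ ψ H qs) ↔
    ((∀ l ∈ H, l.Chosen (fs j)) → ∀ l ∈ qs, l.Chosen (fs j)) := by
  rw [queryAmong, queryChosen_iff]
  simp only [mem_instanceValues_hyp, forall_exists_index, and_imp]
  refine imp_congr ⟨fun h l hl => (infoChosen_iff fs j l).1 (h _ l hl rfl), ?_⟩ Iff.rfl
  rintro h _ l hl rfl
  exact (infoChosen_iff fs j l).2 (h l hl)

end Transfer

end Conditions

/-! ## The three decision problems -/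

variable (ℓ : Lang)

theorem exists_term_lits {qs : List Literal} (h : {l | l ∈ qs}.Nonempty) :
    ∃ σ : Term, σ.lits = qs := by
  rcases qs with _ | ⟨l, ls⟩
  · obtain ⟨l, hl⟩ := h
    simp at hl
  · exact ⟨⟨l, ls⟩, rfl⟩

theorem exists_problem {Γ : List Formula} {ψ : Formula} (hΓ : ∀ φ ∈ Γ, φ.IsBD) (hψ : ψ.IsBD)
    (h : ∃ v, Models Γ v ∧ ¬ (ψ.val v).Designated) (H : List Literal) :
    ∃ P : Problem, P.theory = Γ ∧ P.observation = ψ ∧ P.hypotheses = H := by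
  refine ⟨⟨Γ, ψ, H, hΓ, hψ, ?_⟩, rfl, rfl, rfl⟩
  obtain ⟨v, h1, h2⟩ := h
  exact fun h' => h2 (h' v h1)

theorem Problem.exists_models (P : Problem) :
    ∃ v, Models P.theory v ∧ ¬ (P.observation.val v).Designated := by
  simpa [Entails, Models] using P.not_entails

theorem mem_theoryMinimalRecognition (x : List Sym) : x ∈ theoryMinimalRecognition ℓ ↔
    ∃ Γ ψ H qs, ((∀ φ ∈ Γ, φ.IsBD) ∧ ψ.IsBD) ∧ x = instanceWord Γ ψ H qs ∧
      (∀ l ∈ qs, l ∈ H) ∧ TheoryMinimal ℓ Γ ψ H {l | l ∈ qs} := by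
  constructor
  · rintro ⟨P, σ, rfl, h⟩
    exact ⟨P.theory, P.observation, P.hypotheses, σ.lits, ⟨P.theory_isBD, P.observation_isBD⟩,
      encodeInstance_eq _ _, (P.isTheoryMinimal_iff ℓ σ).1 h⟩
  · rintro ⟨Γ, ψ, H, qs, ⟨hΓ, hψ⟩, rfl, hqs, hmin⟩
    obtain ⟨P, rfl, rfl, rfl⟩ := exists_problem hΓ hψ hmin.1.2.2.1 H
    obtain ⟨σ, rfl⟩ := exists_term_lits hmin.1.1
    exact ⟨P, σ, (encodeInstance_eq _ _).symm, (P.isTheoryMinimal_iff ℓ σ).2 ⟨hqs, hmin⟩⟩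

theorem mem_theoryMinimalRelevance (x : List Sym) : x ∈ theoryMinimalRelevance ℓ ↔
    ∃ Γ ψ H qs, ((∀ φ ∈ Γ, φ.IsBD) ∧ ψ.IsBD) ∧ x = instanceWord Γ ψ H qs ∧
      ∃ h, qs = [h] ∧ h ∈ H ∧ ∃ τ ⊆ {l | l ∈ H}, h ∈ τ ∧ TheoryMinimal ℓ Γ ψ H τ := by
  constructor
  · rintro ⟨P, h, rfl, hh, σ, hσ, hmem⟩
    obtain ⟨h1, h2⟩ := (P.isTheoryMinimal_iff ℓ σ).1 hσ
    exact ⟨P.theory, P.observation, P.hypotheses, [h], ⟨P.theory_isBD, P.observation_isBD⟩,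
      encodeInstance_eq _ _, h, rfl, hh, _, h1, hmem, h2⟩
  · rintro ⟨Γ, ψ, H, qs, ⟨hΓ, hψ⟩, rfl, h, rfl, hh, τ, hτ, hmem, hmin⟩
    obtain ⟨P, rfl, rfl, rfl⟩ := exists_problem hΓ hψ hmin.1.2.2.1 H
    obtain ⟨σ, rfl⟩ := Term.exists_lits _ τ hτ hmin.1.1
    exact ⟨P, h, (encodeInstance_eq _ _).symm, hh, σ,
      (P.isTheoryMinimal_iff ℓ σ).2 ⟨hτ, hmin⟩, hmem⟩

theorem mem_theoryMinimalNecessity (x : List Sym) : x ∈ theoryMinimalNecessity ℓ ↔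
    ∃ Γ ψ H qs, ((∀ φ ∈ Γ, φ.IsBD) ∧ ψ.IsBD) ∧ x = instanceWord Γ ψ H qs ∧
      ∃ h, qs = [h] ∧ h ∈ H ∧ (∃ v, Models Γ v ∧ ¬ (ψ.val v).Designated) ∧
        ∀ τ ⊆ {l | l ∈ H}, TheoryMinimal ℓ Γ ψ H τ → h ∈ τ := by
  constructor
  · rintro ⟨P, h, rfl, hh, hn⟩
    refine ⟨P.theory, P.observation, P.hypotheses, [h], ⟨P.theory_isBD, P.observation_isBD⟩,
      encodeInstance_eq _ _, h, rfl, hh, P.exists_models, fun τ hτ hmin => ?_⟩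
    obtain ⟨σ, rfl⟩ := Term.exists_lits _ τ hτ hmin.1.1
    exact hn σ ((P.isTheoryMinimal_iff ℓ σ).2 ⟨hτ, hmin⟩)
  · rintro ⟨Γ, ψ, H, qs, ⟨hΓ, hψ⟩, rfl, h, rfl, hh, hv, hn⟩
    obtain ⟨P, rfl, rfl, rfl⟩ := exists_problem hΓ hψ hv H
    refine ⟨P, h, (encodeInstance_eq _ _).symm, hh, fun σ hσ => ?_⟩
    obtain ⟨h1, h2⟩ := (P.isTheoryMinimal_iff ℓ σ).1 hσ
    exact hn _ h1 h2

/-- The condition for recognition. -/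
def recognitionCondition (_ : Fin 3) (S : Set (Marker × Info 1)) : Prop :=
  queryAmong 0 S ∧ infoMatrix ℓ S (queryTerm S) 0 1

/-- The condition for relevance. -/
def relevanceCondition (c : Fin 3) (S : Set (Marker × Info 2)) : Prop :=
  c = 1 ∧ queryAmong 1 S ∧ (∀ a ∈ queryTerm S, infoChosen 0 a) ∧
    infoMatrix ℓ S (chosenTerm 0 S) 1 2

/-- The condition for necessity. -/
def necessityCondition (c : Fin 3) (S : Set (Marker × Info 2)) : Prop :=
  -- Necessity may hold because there is no theory-minimal solution at all, so that Γ does not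
  -- entail ψ has to be tested separately. The fifth valuation of the existential block, number 4,
  -- serves this purpose.
  c = 1 ∧ queryAmong 0 S ∧ (theoryHolds S (1, 4) ∧ ¬ observationHolds S (1, 4)) ∧
    ((∀ a ∈ queryTerm S, infoChosen 0 a) ∨ ¬ infoMatrix ℓ S (chosenTerm 0 S) 1 2)

theorem recognition_iff (x : List Sym) : x ∈ theoryMinimalRecognition ℓ ↔
    altFun 2 false fun fs : Fin 2 → ℕ → Cell =>
      Accepts (recognitionCondition ℓ) ((collector 1).value (fun p i => fs i p) x) := by
  rw [mem_theoryMinimalRecognition, ← exists_instanceWord_iff]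
  intro Γ ψ H qs
  change _ ↔ altFun 2 false fun fs => recognitionCondition ℓ _ (instanceValues fs Γ ψ H qs)
  simp only [recognitionCondition, queryAmong_iff, queryTerm_eq, infoMatrix_iff, altFun]
  rw [theoryMinimal_iff]
  change _ ↔ ∀ f : ℕ → Cell, ∃ g : ℕ → Cell,
    ((∀ l ∈ H, l.Chosen f) → ∀ l ∈ qs, l.Chosen f) ∧ cellMatrix ℓ Γ ψ H {l | l ∈ qs} f g
  constructor
  · rintro ⟨h1, h2⟩ f
    obtain ⟨g, hg⟩ := h2 f
    exact ⟨g, fun h l hl => h l (h1 l hl), hg⟩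
  · intro h
    refine ⟨?_, fun f => ?_⟩
    -- The universal choice of exactly the hypotheses turns the test into membership in `H`.
    · obtain ⟨g, hg, -⟩ := h (cells {l | l ∈ H} default)
      simpa using hg
    · obtain ⟨g, -, hg⟩ := h f
      exact ⟨g, hg⟩

theorem length_eq_one_iff_count {Γ : List Formula} {ψ : Formula} {H qs : List Literal} :
    count (instanceBlocks Γ ψ (H.map Literal.toFormula) (qs.map Literal.toFormula)) = 1 ↔
      ∃ h, qs = [h] := by
  rw [count_instanceBlocks, List.length_map, List.length_eq_one_iff]

theorem relevance_iff (x : List Sym) : x ∈ theoryMinimalRelevance ℓ ↔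
    altFun 3 true fun fs : Fin 3 → ℕ → Cell =>
      Accepts (relevanceCondition ℓ) ((collector 2).value (fun p i => fs i p) x) := by
  rw [mem_theoryMinimalRelevance, ← exists_instanceWord_iff]
  intro Γ ψ H qs
  change _ ↔ altFun 3 true fun fs => relevanceCondition ℓ _ (instanceValues fs Γ ψ H qs)
  simp only [relevanceCondition, queryAmong_iff, queryChosen_iff, chosenTerm_eq, infoMatrix_iff,
    altFun, length_eq_one_iff_count]
  simp only [theoryMinimal_iff]
  change _ ↔ ∃ e : ℕ → Cell, ∀ f : ℕ → Cell, ∃ g : ℕ → Cell, (∃ h, qs = [h]) ∧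
    ((∀ l ∈ H, l.Chosen f) → ∀ l ∈ qs, l.Chosen f) ∧ (∀ l ∈ qs, l.Chosen e) ∧
      cellMatrix ℓ Γ ψ H (chosenFrom H e) f g
  constructor
  · rintro ⟨h, rfl, hh, τ, hτ, hmem, hmin⟩
    refine ⟨cells τ default, fun f => ?_⟩
    obtain ⟨g, hg⟩ := hmin f
    refine ⟨g, ⟨h, rfl⟩, fun h' l hl => ?_, ?_, ?_⟩
    · rw [List.mem_singleton] at hl
      exact h' l (hl ▸ hh)
    · simpa using hmem
    · rwa [chosenFrom_cells hτ]
  · rintro ⟨e, he⟩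
    obtain ⟨g, ⟨h, rfl⟩, h1, h2, -⟩ := he (cells {l | l ∈ H} default)
    have hh : h ∈ H := by simpa using h1
    refine ⟨h, rfl, hh, chosenFrom H e, fun l hl => hl.1, ⟨hh, by simpa using h2⟩, fun f => ?_⟩
    obtain ⟨g, -, -, -, hg⟩ := he f
    exact ⟨g, hg⟩

theorem necessity_iff (x : List Sym) : x ∈ theoryMinimalNecessity ℓ ↔
    altFun 3 false fun fs : Fin 3 → ℕ → Cell =>
      Accepts (necessityCondition ℓ) ((collector 2).value (fun p i => fs i p) x) := by
  rw [mem_theoryMinimalNecessity, ← exists_instanceWord_iff]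
  intro Γ ψ H qs
  change _ ↔ altFun 3 false fun fs => necessityCondition ℓ _ (instanceValues fs Γ ψ H qs)
  simp only [necessityCondition, queryAmong_iff, queryChosen_iff, chosenTerm_eq, infoMatrix_iff,
    altFun, length_eq_one_iff_count, theoryHolds_iff, observationHolds_iff]
  change _ ↔ ∀ e : ℕ → Cell, ∃ f : ℕ → Cell, ∀ g : ℕ → Cell, (∃ h, qs = [h]) ∧
    ((∀ l ∈ H, l.Chosen e) → ∀ l ∈ qs, l.Chosen e) ∧
    (Models Γ (point f 4) ∧ ¬ (ψ.val (point f 4)).Designated) ∧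
      ((∀ l ∈ qs, l.Chosen e) ∨ ¬ cellMatrix ℓ Γ ψ H (chosenFrom H e) f g)
  constructor
  · rintro ⟨h, rfl, hh, ⟨v, hv⟩, hn⟩ e
    have h1 : (∀ l ∈ H, l.Chosen e) → ∀ l ∈ [h], l.Chosen e := by
      intro h' l hl
      rw [List.mem_singleton] at hl
      exact h' l (hl ▸ hh)
    -- A minimal choice contains `h`. For any other choice the failure of the prenex form yields a
    -- competitor and universal valuations that refute the matrix against every `g`.
    by_cases hmin : TheoryMinimal ℓ Γ ψ H (chosenFrom H e)
    · have := (hn _ (fun l hl => hl.1) hmin).2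
      exact ⟨cells ∅ fun _ => v, fun g => ⟨⟨h, rfl⟩, h1, hv, .inl (by simpa using this)⟩⟩
    · rw [TheoryMinimal, minimal_iff_matrix] at hmin
      simp only [not_forall, not_exists] at hmin
      obtain ⟨φ, hφ, u, hu⟩ := hmin
      have h4 : (Fin.snoc u v : Fin 5 → ℕ → Four) 4 = v := rfl
      refine ⟨cells φ (Fin.snoc u v), fun g => ⟨⟨h, rfl⟩, h1, ?_, .inr ?_⟩⟩
      · rwa [point_cells, h4]
      · simpa [cellMatrix, chosenFrom_cells hφ] using hu fun i => point g i.castSucc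
  · intro he
    obtain ⟨f, hf⟩ := he (cells {l | l ∈ H} default)
    obtain ⟨⟨h, rfl⟩, h1, h2, -⟩ := hf default
    have hh : h ∈ H := by simpa using h1
    refine ⟨h, rfl, hh, ⟨_, h2⟩, fun τ hτ hmin => ?_⟩
    obtain ⟨f, hf⟩ := he (cells τ default)
    obtain ⟨g, hg⟩ := (theoryMinimal_iff ℓ Γ ψ H τ).1 hmin f
    obtain ⟨-, -, -, h3 | h3⟩ := hf g
    · simpa using h3
    · rw [chosenFrom_cells hτ] at h3
      exact absurd hg h3

end BDAbduction

theorem theorem5p4 (ℓ : BDAbduction.Lang) :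
    PolyHierarchy.InPiP 2 (BDAbduction.theoryMinimalRecognition ℓ) ∧
    PolyHierarchy.InSigmaP 3 (BDAbduction.theoryMinimalRelevance ℓ) ∧
    PolyHierarchy.InPiP 3 (BDAbduction.theoryMinimalNecessity ℓ) := by
  refine ⟨?_, ?_, ?_⟩
  · refine BDAbduction.inSigmaP_of_automaton (BDAbduction.collector 1)
      (fun q => ¬ BDAbduction.Accepts (BDAbduction.recognitionCondition ℓ) q) fun x => ?_
    -- Negation turns the prefix ∀∃ into ∃∀. Words that encode no instance lie in the complement, in
    -- accordance with the negated acceptance condition.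
    rw [Set.mem_compl_iff, BDAbduction.recognition_iff, BDAbduction.not_altFun]
    rfl
  · exact BDAbduction.inSigmaP_of_automaton (BDAbduction.collector 2) _
      (BDAbduction.relevance_iff ℓ)
  · refine BDAbduction.inSigmaP_of_automaton (BDAbduction.collector 2)
      (fun q => ¬ BDAbduction.Accepts (BDAbduction.necessityCondition ℓ) q) fun x => ?_
    rw [Set.mem_compl_iff, BDAbduction.necessity_iff, BDAbduction.not_altFun]
    rfl
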